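/- **Setting.** Let $\mathbf D$ be a finite semi-primal algebra (every operation $D^n\to D$, $n\ge 1$, which preserves all subalgebras of $\mathbf D$ is a term operation) which has a bounded lattice reduct $\langle D,\wedge,\vee,0,1\rangle$ with $0\neq 1$. Let $\mathcal A$ be the variety generated by $\mathbf D$, and let $\mathbb S(\mathbf D)$ be the set of subalgebras of $\mathbf D$ ordered by inclusion, with largest element $\top=\mathbf D$. Let $\mathsf{Set}_{\mathbf D}$ be the category of pairs $(X,v)$ with $X$ a set and $v\colon X\to\mathbb S(\mathbf D)$; a morphism $(X,v)\to(Y,w)$ is a map $f\colon X\to Y$ with $w(f(x))\le v(x)$ for all $x$. Given functors $\mathsf S\colon\mathcal V\to\mathcal C^{\mathrm{op}}$ and $\mathsf P\colon\mathcal C^{\mathrm{op}}\to\mathcal V$ with $\mathsf S\dashv\mathsf P$, with canonical maps $\eta\colon A\to\mathsf{PS}A$ and $\varepsilon\colon X\to\mathsf{SP}X$, and given an endofunctor $\mathsf T$ of $\mathcal C$, an *abstract coalgebraic logic* for $\mathsf T$ is a pair $(\mathsf L,\delta)$ of a functor $\mathsf L\colon\mathcal V\to\mathcal V$ and a natural transformation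 $\delta\colon\mathsf{LP}\Rightarrow\mathsf{PT}$. It is *one-step complete* if every component of $\delta$ is a monomorphism. For $\mathcal C=\mathsf{Set}$ it is *expressive* if the category of $\mathsf L$-algebras has an initial object, $\mathsf T$ preserves monomorphisms, and every component of the adjoint transpose $$\delta^\dagger_A\colon\ \mathsf{TS}A\xrightarrow{\ \varepsilon\ }\mathsf{SPTS}A\xrightarrow{\ \mathsf S\delta_{\mathsf SA}\ }\mathsf{SLPS}A\xrightarrow{\ \mathsf{SL}\eta_A\ }\mathsf{SL}A$$ is a monomorphism (the factorization system being the epi-mono factorizations of $\mathsf{Set}$). Two dual adjunctions are used. The classical one consists of $\mathsf S\colon\mathsf{BA}\to\mathsf{Set}^{\mathrm{op}}$ (ultrafilters) and $\mathsf P\colon\mathsf{Set}^{\mathrm{op}}\to\mathsf{BA}$ (powerset); coalgebraic logics over it are called *classical*. The many-valued one consists of $\mathsf S'\colon\mathcal A\to\mathsf{Set}_{\mathbf D}^{\mathrm{op}}$, $\mathsf S'A=(\mathcal A(A,\mathbf D),\,h\mapsto h(A))$, and $\mathsf P'\colon\mathsf{Set}_{\mathbf D}^{\mathrm{op}}\to\mathcal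 A$, $\mathsf P'(X,v)=\prod_{x\in X}v(x)$. For $\mathbf S\in\mathbb S(\mathbf D)$ let $\mathsf V^{\mathbf S}\colon\mathsf{Set}\to\mathsf{Set}_{\mathbf D}$ send $X$ to $X$ with all labels equal to $\mathbf S$; its right adjoint $\mathsf C^{\mathbf S}$ sends $(X,v)$ to $\{x: v(x)\le\mathbf S\}$. In particular $\mathsf C^\top=\mathsf U$ is the forgetful functor. For $A\in\mathcal A$ let $\mathsf K_{\mathbf S}A$ be the Boolean skeleton of $A/\theta_{\mathbf S}$. Here $a\mathrel{\theta_{\mathbf S}}b$ iff $h(a)=h(b)$ for every homomorphism $h\colon A\to\mathbf D$ with $h(A)\subseteq\mathbf S$, and the Boolean skeleton of an algebra in $\mathcal A$ is the Boolean algebra of its elements fixed by the term operation $T_1$, where $T_1$ is interpreted in $\mathbf D$ as $T_1(1)=1$ and $T_1(d)=0$ for $d\ne 1$. For a Boolean algebra $B$ let $\mathfrak P_{\mathbf S}B$ be the Boolean power of $\mathbf S$ by $B$: the families $(\xi(d))_{d\in S}$ of pairwise disjoint elements of $B$ with join $1$, with operations $o(\xi_1,\dots,\xi_n)(d)=\bigvee\{\xi_1(d_1)\wedge\dots\wedge\xi_n(d_n):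 o(d_1,\dots,d_n)=d\}$. **Liftings.** For $\mathsf T\colon\mathsf{Set}\to\mathsf{Set}$ and $\mathsf L\colon\mathsf{BA}\to\mathsf{BA}$ put $$\mathsf T'(X,v)=\int^{\mathbf S\in\mathbb S(\mathbf D)}\mathsf V^{\mathbf S}\mathsf T\,\mathsf C^{\mathbf S}(X,v),\qquad \mathsf L'A=\int_{\mathbf S\in\mathbb S(\mathbf D)}\mathfrak P_{\mathbf S}\,\mathsf L\,\mathsf K_{\mathbf S}A .$$ For a classical abstract coalgebraic logic $(\mathsf L,\delta)$ for $\mathsf T$, let $\delta'\colon\mathsf{L'P'}\Rightarrow\mathsf{P'T'}$ be the natural transformation for which, for all $\mathbf S$, the composite of $\delta'_{(X,v)}$ with $\mathsf P'$ of the coend injection $\mathsf V^{\mathbf S}\mathsf T\mathsf C^{\mathbf S}(X,v)\to\mathsf T'(X,v)$ is $$\mathsf{L'P'}(X,v)\to\mathfrak P_{\mathbf S}\mathsf L\mathsf K_{\mathbf S}\mathsf P'(X,v)\cong\mathfrak P_{\mathbf S}\mathsf{LP}\mathsf C^{\mathbf S}(X,v)\xrightarrow{\mathfrak P_{\mathbf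 S}\delta}\mathfrak P_{\mathbf S}\mathsf{PT}\mathsf C^{\mathbf S}(X,v)\cong\mathsf P'\mathsf V^{\mathbf S}\mathsf T\mathsf C^{\mathbf S}(X,v),$$ the first map being the end projection and the isomorphisms being the canonical ones. The pair $(\mathsf L',\delta')$ is an abstract coalgebraic logic for $\mathsf T'$, called the *lifting* of $(\mathsf L,\delta)$. For a set $X$ let $\kappa_X\colon\mathsf V^\top\mathsf TX=\mathsf V^\top\mathsf T\mathsf C^\top\mathsf V^\top X\to\mathsf T'\mathsf V^\top X$ be the coend injection at $\mathbf S=\top$ (on underlying sets it is, up to isomorphism, the identity of $\mathsf TX$), and define $$\delta^\top_X:=\Big(\mathsf{L'P'V}^\top X\xrightarrow{\ \delta'_{\mathsf V^\top X}\ }\mathsf{P'T'V}^\top X\xrightarrow{\ \mathsf P'\kappa_X\ }\mathsf{P'V}^\top\mathsf TX\Big).$$ When $\mathsf T'\mathsf V^\top=\mathsf V^\top\mathsf T$ (with $\kappa$ the identity), this is $\delta^\top=\delta'\mathsf V^\top$. **Statement.** Let $\mathsf T\colon\mathsf{Set}\to\mathsf{Set}$ be a functor and let $(\mathsf L,\delta)$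 be a classical abstract coalgebraic logic for $\mathsf T$ such that both $\mathsf L\colon\mathsf{BA}\to\mathsf{BA}$ and $\mathsf T$ preserve monomorphisms and epimorphisms. Then the maps $\delta^\top_X$ form a natural transformation $\mathsf{L'}(\mathsf{P'V}^\top)\Rightarrow(\mathsf{P'V}^\top)\mathsf T$. Hence $(\mathsf L',\delta^\top)$ is an abstract coalgebraic logic for $\mathsf T$ over the composite dual adjunction $\mathsf{US'}\dashv\mathsf{P'V}^\top$ between $\mathcal A$ and $\mathsf{Set}$, where $\mathsf{P'V}^\top X=\mathbf D^X$ (arbitrary $D$-valued predicates on $X$). Moreover: 1. if $(\mathsf L,\delta)$ is one-step complete, then so is $(\mathsf L',\delta^\top)$; 2. if $(\mathsf L,\delta)$ is expressive, then so is $(\mathsf L',\delta^\top)$. -/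

import Mathlib

open CategoryTheory Limits Opposite FirstOrder Language Structure

universe u a b

namespace ManyValued

set_option linter.unusedSectionVars false

section Algebra

variable (ℒ : FirstOrder.Language.{a, b})

/-- `A` belongs to the variety generated by `D`: every identity `s ≈ t` (between terms in finitely
many variables) which holds in `D` also holds in `A`. -/
def InVariety (D A : Type*) [ℒ.Structure D] [ℒ.Structure A] : Prop :=
  ∀ (n : ℕ) (s t : ℒ.Term (Fin n)),
    (∀ x : Fin n → D, s.realize x = t.realize x) → ∀ x : Fin n → A, s.realize x = t.realize x

/-- A finite algebra `D` is semi-primal if every operation of positive arity on `D` which preserves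
all subalgebras is term-definable in `D`. -/
class SemiPrimal (D : Type*) [Fintype D] [ℒ.Structure D] : Prop where
  exists_term : ∀ n : ℕ, 1 ≤ n → ∀ f : (Fin n → D) → D,
    (∀ S : ℒ.Substructure D, ∀ x : Fin n → D, (∀ i, x i ∈ S) → f x ∈ S) →
      ∃ t : ℒ.Term (Fin n), ∀ x, t.realize x = f x

/-- The bounded lattice `D` is a reduct of the algebra `D`: the lattice operations and the two
bounds are among its basic operations. -/
class BoundedLatticeReduct (D : Type*) [ℒ.Structure D] [Lattice D] [BoundedOrder D] where
  infSym : ℒ.Functions 2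
  supSym : ℒ.Functions 2
  botSym : ℒ.Functions 0
  topSym : ℒ.Functions 0
  funMap_infSym : ∀ x : Fin 2 → D, funMap infSym x = x 0 ⊓ x 1
  funMap_supSym : ∀ x : Fin 2 → D, funMap supSym x = x 0 ⊔ x 1
  funMap_botSym : ∀ x : Fin 0 → D, funMap botSym x = ⊥
  funMap_topSym : ∀ x : Fin 0 → D, funMap topSym x = ⊤

variable {ℒ}

theorem InVariety.refl (D : Type*) [ℒ.Structure D] : InVariety ℒ D D := fun _ _ _ h => h

theorem InVariety.of_jointly_injective {D A : Type*} [ℒ.Structure D] [ℒ.Structure A]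
    {ι : Type*} {B : ι → Type*} [∀ i, ℒ.Structure (B i)] (hB : ∀ i, InVariety ℒ D (B i))
    (h : ∀ i, A →[ℒ] B i) (hinj : ∀ x y, (∀ i, h i x = h i y) → x = y) : InVariety ℒ D A := by
  intro n s t hst x
  refine hinj _ _ fun i => ?_
  rw [← HomClass.realize_term, ← HomClass.realize_term]
  exact hB i n s t hst _

theorem InVariety.of_surjective {D A B : Type*} [ℒ.Structure D] [ℒ.Structure A] [ℒ.Structure B]
    (hA : InVariety ℒ D A) (h : A →[ℒ] B) (hs : Function.Surjective h) : InVariety ℒ D B := by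
  intro n s t hst x
  choose g hg using hs
  have hx : x = h ∘ (g ∘ x) := by ext i; simp [hg]
  rw [hx, HomClass.realize_term, HomClass.realize_term, hA n s t hst]

/-- A family of operations is a homomorphism as soon as it respects the function symbols, since
there are no relation symbols. -/
def homOfFun [ℒ.IsAlgebraic] {A B : Type*} [ℒ.Structure A] [ℒ.Structure B] (f : A → B)
    (hf : ∀ (n : ℕ) (φ : ℒ.Functions n) (x : Fin n → A), f (funMap φ x) = funMap φ (f ∘ x)) :
    A →[ℒ] B where
  toFun := f
  map_fun' φ x := hf _ φ x
  map_rel' r := (IsEmpty.false r).elim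

@[simp] theorem homOfFun_apply [ℒ.IsAlgebraic] {A B : Type*} [ℒ.Structure A] [ℒ.Structure B]
    (f : A → B) (hf) (x : A) : homOfFun (ℒ := ℒ) f hf x = f x := rfl

end Algebra

section Variety

variable (ℒ : FirstOrder.Language.{a, b}) (D : Type u) [ℒ.Structure D]

/-- An algebra in the variety generated by `D`. -/
structure Variety where
  carrier : Type u
  [str : ℒ.Structure carrier]
  mem : InVariety ℒ D carrier

attribute [instance] Variety.str

variable {ℒ D}

/-- Homomorphisms of algebras. -/
@[ext]
structure Variety.Hom (A B : Variety ℒ D) where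
  hom : A.carrier →[ℒ] B.carrier

instance : Category (Variety ℒ D) where
  Hom := Variety.Hom
  id A := ⟨FirstOrder.Language.Hom.id ℒ A.carrier⟩
  comp f g := ⟨g.hom.comp f.hom⟩

@[ext]
theorem Variety.hom_ext {A B : Variety ℒ D} {f g : A ⟶ B} (h : ∀ x, f.hom x = g.hom x) : f = g :=
  Variety.Hom.ext (FirstOrder.Language.Hom.ext h)

@[simp] theorem Variety.id_hom (A : Variety ℒ D) : Variety.Hom.hom (𝟙 A) = .id ℒ A.carrier := rfl

@[simp] theorem Variety.comp_hom {A B C : Variety ℒ D} (f : A ⟶ B) (g : B ⟶ C) :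
    (f ≫ g).hom = g.hom.comp f.hom := rfl

theorem Variety.hom_funMap {A B : Variety ℒ D} (f : A ⟶ B) {n : ℕ} (φ : ℒ.Functions n)
    (x : Fin n → A.carrier) : f.hom (funMap φ x) = funMap φ (f.hom ∘ x) :=
  f.hom.map_fun φ x

/-- `D` as a member of the variety which it generates. -/
abbrev Variety.gen : Variety ℒ D where
  carrier := D
  mem := .refl D

section Limits

variable [ℒ.IsAlgebraic] {J : Type u} [Category.{u} J] (F : J ⥤ Variety ℒ D)

/-- The subalgebra of the product consisting of the compatible families. -/
@[ext]
structure Variety.LimitType : Type u where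
  val : ∀ j, (F.obj j).carrier
  property : ∀ {i j} (f : i ⟶ j), (F.map f).hom (val i) = val j

instance : ℒ.Structure (Variety.LimitType F) where
  funMap φ x := ⟨fun j => funMap φ fun k => (x k).1 j, fun {i j} f => by
    rw [Variety.hom_funMap]
    congr 1
    ext k
    exact (x k).2 f⟩
  RelMap r := (IsEmpty.false r).elim

/-- The projections. -/
def Variety.limitProj (j : J) : Variety.LimitType F →[ℒ] (F.obj j).carrier :=
  homOfFun (fun x => x.1 j) fun _ _ _ => rfl

/-- The limit cone of compatible families. -/
def Variety.limitCone : Cone F where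
  pt := { carrier := Variety.LimitType F
          mem := .of_jointly_injective (fun j => (F.obj j).mem) (Variety.limitProj F)
            fun _ _ h => Variety.LimitType.ext (funext h) }
  π := { app j := ⟨Variety.limitProj F j⟩
         naturality i j f := by
          ext x
          exact (x.2 f).symm }

/-- The cone of compatible families is a limit cone. -/
def Variety.limitConeIsLimit : IsLimit (Variety.limitCone F) where
  lift s := ⟨homOfFun (fun x => ⟨fun j => (s.π.app j).hom x, fun {i j} f => by
      have := s.w f
      exact congrArg (fun g => Variety.Hom.hom g x) this⟩) fun n φ x =>
        Variety.LimitType.ext (funext fun j => Variety.hom_funMap (s.π.app j) φ x)⟩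
  fac s j := rfl
  uniq s m h := by
    ext x
    refine Variety.LimitType.ext (funext fun j => ?_)
    exact congrArg (fun g => Variety.Hom.hom g x) (h j)

instance : HasLimitsOfSize.{u, u} (Variety ℒ D) where
  has_limits_of_shape _ _ := ⟨fun F => ⟨⟨_, Variety.limitConeIsLimit F⟩⟩⟩

end Limits

end Variety

section SetD

variable (ℒ : FirstOrder.Language.{a, b}) (D : Type u) [ℒ.Structure D]

/-- Objects of `Set_D`: sets in which every point is labelled by a subalgebra of `D`. -/
structure SetD where
  carrier : Type u
  val : carrier → ℒ.Substructure D

variable {ℒ D}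

/-- Morphisms of `Set_D`: maps which do not increase the labels. -/
@[ext]
structure SetD.Hom (X Y : SetD ℒ D) where
  toFun : X.carrier → Y.carrier
  val_le : ∀ x, Y.val (toFun x) ≤ X.val x

instance : Category (SetD ℒ D) where
  Hom := SetD.Hom
  id X := ⟨id, fun _ => le_rfl⟩
  comp f g := ⟨g.toFun ∘ f.toFun, fun x => (g.val_le _).trans (f.val_le x)⟩

@[ext]
theorem SetD.hom_ext {X Y : SetD ℒ D} {f g : X ⟶ Y} (h : ∀ x, f.toFun x = g.toFun x) : f = g :=
  SetD.Hom.ext (funext h)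

@[simp] theorem SetD.id_toFun (X : SetD ℒ D) : SetD.Hom.toFun (𝟙 X) = id := rfl

@[simp] theorem SetD.comp_toFun {X Y Z : SetD ℒ D} (f : X ⟶ Y) (g : Y ⟶ Z) :
    (f ≫ g).toFun = g.toFun ∘ f.toFun := rfl

/-- The forgetful functor to sets. -/
@[simps]
def SetD.forgetful : SetD ℒ D ⥤ Type u where
  obj X := X.carrier
  map f := ↾f.toFun

section Colimits

variable {J : Type u} [Category.{u} J] (F : J ⥤ SetD ℒ D)

/-- The colimit cocone: on the colimit of the underlying sets, the label of a point is the meet of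
the labels of all its representatives. -/
noncomputable def SetD.colimitCocone : Cocone F where
  pt := { carrier := colimit (F ⋙ SetD.forgetful)
          val z := sInf {S | ∃ (j : J) (x : (F.obj j).carrier),
            colimit.ι (F ⋙ SetD.forgetful) j x = z ∧ S = (F.obj j).val x} }
  ι := { app j := ⟨fun x => colimit.ι (F ⋙ SetD.forgetful) j x, fun x => sInf_le ⟨j, x, rfl, rfl⟩⟩
         naturality i j f := by
          ext x
          exact ConcreteCategory.congr_hom (colimit.w (F ⋙ SetD.forgetful) f) x }

/-- The cocone above is a colimit cocone. -/
noncomputable def SetD.colimitCoconeIsColimit : IsColimit (SetD.colimitCocone F) where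
  desc s := ⟨fun z => colimit.desc (F ⋙ SetD.forgetful) (SetD.forgetful.mapCocone s) z, by
    intro z
    refine le_sInf ?_
    rintro _ ⟨j, x, rfl, rfl⟩
    have : colimit.desc (F ⋙ SetD.forgetful) (SetD.forgetful.mapCocone s)
        (colimit.ι (F ⋙ SetD.forgetful) j x) = (s.ι.app j).toFun x :=
      ConcreteCategory.congr_hom (colimit.ι_desc (SetD.forgetful.mapCocone s) j) x
    rw [this]
    exact (s.ι.app j).val_le x⟩
  fac s j := by
    ext x
    exact ConcreteCategory.congr_hom (colimit.ι_desc (SetD.forgetful.mapCocone s) j) x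
  uniq s m h := by
    have : SetD.forgetful.map m =
        colimit.desc (F ⋙ SetD.forgetful) (SetD.forgetful.mapCocone s) := by
      refine colimit.hom_ext fun j => ?_
      rw [colimit.ι_desc]
      exact congrArg SetD.forgetful.map (h j)
    ext z
    exact ConcreteCategory.congr_hom this z

instance : HasColimitsOfSize.{u, u} (SetD ℒ D) where
  has_colimits_of_shape _ _ := ⟨fun F => ⟨⟨_, SetD.colimitCoconeIsColimit F⟩⟩⟩

end Colimits

end SetD

section DualAdjunction

variable {ℒ : FirstOrder.Language.{a, b}} {D : Type u} [ℒ.Structure D]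

/-- The set of all homomorphisms `A → D`, labelled by their images. -/
def Variety.homs (A : Variety ℒ D) : SetD ℒ D where
  carrier := A.carrier →[ℒ] D
  val u := u.range

/-- Precomposition with a homomorphism. -/
def Variety.precomp {A B : Variety ℒ D} (h : A ⟶ B) : B.homs ⟶ A.homs where
  toFun (u : B.carrier →[ℒ] D) := u.comp h.hom
  val_le u := by
    rintro _ ⟨x, rfl⟩
    exact ⟨h.hom x, rfl⟩

/-- `S'`: an algebra `A` is sent to the set of all homomorphisms `A → D`, labelled by their
images, and a homomorphism to precomposition with it. -/
def homFunctor : Variety ℒ D ⥤ (SetD ℒ D)ᵒᵖ where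
  obj A := op A.homs
  map h := (Variety.precomp h).op

variable [ℒ.IsAlgebraic]

/-- The carrier of `∏ x, v x`, as a subset of `D ^ X`. -/
@[ext]
structure SetD.Prod (X : SetD ℒ D) : Type u where
  val : X.carrier → D
  property : ∀ x, val x ∈ X.val x

instance (X : SetD ℒ D) : ℒ.Structure X.Prod where
  funMap φ α := ⟨fun x => funMap φ fun k => (α k).1 x, fun x =>
    (X.val x).fun_mem φ _ fun k => (α k).2 x⟩
  RelMap r := (IsEmpty.false r).elim

/-- Evaluation at a point. -/
def SetD.eval (X : SetD ℒ D) (x : X.carrier) : X.Prod →[ℒ] D :=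
  homOfFun (fun α => α.1 x) fun _ _ _ => rfl

/-- The product `∏ x, v x`. -/
def SetD.prod (X : SetD ℒ D) : Variety ℒ D where
  carrier := X.Prod
  mem := .of_jointly_injective (fun _ => .refl D) X.eval fun _ _ h => SetD.Prod.ext (funext h)

/-- Precomposition with a morphism of `Set_D`. -/
def SetD.precomp {X Y : SetD ℒ D} (f : X ⟶ Y) : Y.prod ⟶ X.prod :=
  ⟨homOfFun (A := Y.Prod) (B := X.Prod)
    (fun α => ⟨fun x => α.1 (f.toFun x), fun x => f.val_le x (α.2 _)⟩) fun _ _ _ => rfl⟩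

/-- `P'`: the object `(X, v)` of `Set_D` is sent to the product `∏ x, v x`, and a morphism to
precomposition with it. -/
def prodFunctor : (SetD ℒ D)ᵒᵖ ⥤ Variety ℒ D where
  obj X := X.unop.prod
  map f := SetD.precomp f.unop

/-- The unit `η'` of the dual adjunction, `a ↦ ev_a`. -/
def prodUnit (A : Variety ℒ D) : A ⟶ A.homs.prod :=
  ⟨homOfFun (B := A.homs.Prod) (fun a => ⟨fun (u : A.carrier →[ℒ] D) => u a, fun _ => ⟨a, rfl⟩⟩)
    fun _ φ x => SetD.Prod.ext (funext fun (u : A.carrier →[ℒ] D) => u.map_fun φ x)⟩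

/-- The unit `ε'` of the dual adjunction, `x ↦ ev_x`. -/
def prodCounit (X : SetD ℒ D) : X ⟶ X.prod.homs where
  toFun := X.eval
  val_le x := by
    rintro _ ⟨α, rfl⟩
    exact SetD.Prod.property α x

/-- The dual adjunction between `Set_D` and the variety generated by `D`. -/
def prodAdjunction : (homFunctor : Variety ℒ D ⥤ (SetD ℒ D)ᵒᵖ) ⊣ prodFunctor :=
  Adjunction.mkOfUnitCounit
    { unit :=
        { app := prodUnit
          naturality _ _ _ := rfl }
      counit :=
        { app X := (prodCounit X.unop).op
          naturality _ _ _ := rfl }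
      left_triangle := rfl
      right_triangle := rfl }

end DualAdjunction

section Classical

/-- The ultrafilters of a Boolean algebra. -/
structure BoolUltrafilter (B : Type u) [BooleanAlgebra B] where
  sets : Set B
  top_mem : ⊤ ∈ sets
  inf_mem : ∀ a b, a ∈ sets → b ∈ sets → a ⊓ b ∈ sets
  mem_of_le : ∀ a b, a ∈ sets → a ≤ b → b ∈ sets
  compl_mem_iff : ∀ a, aᶜ ∈ sets ↔ a ∉ sets

theorem BoolUltrafilter.ext' {B : Type u} [BooleanAlgebra B] {U V : BoolUltrafilter B}
    (h : ∀ b, b ∈ U.sets ↔ b ∈ V.sets) : U = V := by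
  cases U; cases V
  congr
  exact Set.ext h

theorem BoolUltrafilter.inf_mem_iff {B : Type u} [BooleanAlgebra B] (U : BoolUltrafilter B)
    (a b : B) : a ⊓ b ∈ U.sets ↔ a ∈ U.sets ∧ b ∈ U.sets :=
  ⟨fun h => ⟨U.mem_of_le _ _ h inf_le_left, U.mem_of_le _ _ h inf_le_right⟩,
    fun h => U.inf_mem _ _ h.1 h.2⟩

theorem BoolUltrafilter.sup_mem_iff {B : Type u} [BooleanAlgebra B] (U : BoolUltrafilter B)
    (a b : B) : a ⊔ b ∈ U.sets ↔ a ∈ U.sets ∨ b ∈ U.sets := by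
  have h := U.compl_mem_iff (a ⊔ b)
  rw [compl_sup, U.inf_mem_iff, U.compl_mem_iff, U.compl_mem_iff] at h
  tauto

/-- Ultrafilters pull back along homomorphisms. -/
def BoolUltrafilter.comap {B C : BoolAlg.{u}} (h : B ⟶ C) (U : BoolUltrafilter C) :
    BoolUltrafilter B where
  sets := {b | h b ∈ U.sets}
  top_mem := by simpa using U.top_mem
  inf_mem a b ha hb := by simpa using U.inf_mem _ _ ha hb
  mem_of_le a b ha hab := U.mem_of_le _ _ ha (OrderHomClass.mono h.hom hab)
  compl_mem_iff a := by simpa using U.compl_mem_iff (h a)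

/-- `S`: a Boolean algebra is sent to its set of ultrafilters. -/
def ultrafilterFunctor : BoolAlg.{u} ⥤ (Type u)ᵒᵖ where
  obj B := op (BoolUltrafilter B)
  map h := Quiver.Hom.op (↾(BoolUltrafilter.comap h))

/-- `P`: a set is sent to its powerset algebra, a map to its preimage map. -/
def powersetFunctor : (Type u)ᵒᵖ ⥤ BoolAlg.{u} := typeToBoolAlgOp.leftOp

/-- The unit `η` of the classical dual adjunction, `b ↦ {U | b ∈ U}`. -/
def powersetUnit (B : BoolAlg.{u}) : B ⟶ powersetFunctor.obj (ultrafilterFunctor.obj B) :=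
  BoolAlg.ofHom (Y := Set (BoolUltrafilter B))
    { toFun b := {U | b ∈ U.sets}
      map_sup' a b := Set.ext fun U => U.sup_mem_iff a b
      map_inf' a b := Set.ext fun U => U.inf_mem_iff a b
      map_top' := Set.ext fun U => iff_of_true U.top_mem trivial
      map_bot' := Set.ext fun U => iff_of_false (fun h => by
        have := U.compl_mem_iff ⊥
        rw [compl_bot] at this
        exact this.1 U.top_mem h) id }

/-- The unit `ε` of the classical dual adjunction, sending a point to its principal ultrafilter. -/
def powersetCounit (X : Type u) : X ⟶ (ultrafilterFunctor.obj (powersetFunctor.obj (op X))).unop :=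
  ↾fun x => (BoolUltrafilter.mk {Y : Set X | x ∈ Y} trivial (fun _ _ h h' => ⟨h, h'⟩)
    (fun _ _ h h' => h' h) (fun _ => Iff.rfl) : BoolUltrafilter (Set X))

/-- The dual adjunction between sets and Boolean algebras. -/
def powersetAdjunction : ultrafilterFunctor.{u} ⊣ powersetFunctor :=
  Adjunction.mkOfUnitCounit
    { unit := { app := powersetUnit }
      counit := { app X := (powersetCounit X.unop).op } }

end Classical

section Subalgebra

variable {ℒ : FirstOrder.Language.{a, b}} {D : Type u} [ℒ.Structure D]

/-- `V^S`: every point of a set is labelled by `S`. -/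
def constLabel (S : ℒ.Substructure D) : Type u ⥤ SetD ℒ D where
  obj X := ⟨X, fun _ => S⟩
  map f := ⟨f, fun _ => le_rfl⟩

/-- The set of points with a label below `S`. -/
@[ext]
structure SetD.Below (X : SetD ℒ D) (S : ℒ.Substructure D) : Type u where
  val : X.carrier
  property : X.val val ≤ S

/-- `C^S`: an object of `Set_D` is sent to the set of points with a label below `S`. -/
def below (S : ℒ.Substructure D) : SetD ℒ D ⥤ Type u where
  obj X := X.Below S
  map {X Y} f := ↾fun x : X.Below S => (⟨f.toFun x.1, (f.val_le _).trans x.2⟩ : Y.Below S)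

/-- The unit of `V^S ⊣ C^S`. -/
def constLabelUnit (S : ℒ.Substructure D) (X : Type u) : X ⟶ ((constLabel S).obj X).Below S :=
  ↾fun x => (⟨x, le_rfl⟩ : ((constLabel S).obj X).Below S)

/-- The counit of `V^S ⊣ C^S`. -/
def constLabelCounit (S : ℒ.Substructure D) (X : SetD ℒ D) :
    (constLabel S).obj (X.Below S) ⟶ X where
  toFun (x : X.Below S) := x.1
  val_le (x : X.Below S) := x.2

/-- The adjunction `V^S ⊣ C^S`. -/
def constLabelAdjunction (S : ℒ.Substructure D) :
    (constLabel S : Type u ⥤ SetD ℒ D) ⊣ below S :=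
  Adjunction.mkOfUnitCounit
    { unit :=
        { app := constLabelUnit S
          naturality _ _ _ := rfl }
      counit :=
        { app := constLabelCounit S
          naturality _ _ _ := rfl }
      left_triangle := rfl
      right_triangle := rfl }

/-- For `S₁ ≤ S₂` the identity map is a morphism `V^{S₂} X → V^{S₁} X`. -/
def constLabelMap {S₁ S₂ : ℒ.Substructure D} (h : S₁ ≤ S₂) :
    (constLabel S₂ : Type u ⥤ SetD ℒ D) ⟶ constLabel S₁ where
  app X := ⟨id, fun _ => h⟩

/-- For `S₁ ≤ S₂` there is an inclusion `C^{S₁} (X, v) → C^{S₂} (X, v)`. -/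
def belowMap {S₁ S₂ : ℒ.Substructure D} (h : S₁ ≤ S₂) :
    (below S₁ : SetD ℒ D ⥤ Type u) ⟶ below S₂ where
  app X := ↾fun x : X.Below S₁ => (⟨x.1, x.2.trans h⟩ : X.Below S₂)
  naturality _ _ _ := rfl

/-- `C^R`, as a functor of `R`. -/
def belowFunctor : ℒ.Substructure D ⥤ SetD ℒ D ⥤ Type u where
  obj := below
  map h := belowMap h.le

/-- `V^S`, as a contravariant functor of `S`. -/
def constLabelFunctor : (ℒ.Substructure D)ᵒᵖ ⥤ Type u ⥤ SetD ℒ D where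
  obj S := constLabel S.unop
  map h := constLabelMap h.unop.le

/-- The diagram `(S, R) ↦ V^S T C^R (X, v)`, functorially in `(X, v)`. -/
def coendDiagram (T : Type u ⥤ Type u) :
    SetD ℒ D ⥤ (ℒ.Substructure D)ᵒᵖ ⥤ ℒ.Substructure D ⥤ SetD ℒ D where
  obj X :=
    { obj S := belowFunctor.flip.obj X ⋙ T ⋙ constLabelFunctor.obj S
      map h := Functor.whiskerLeft _ (Functor.whiskerLeft T (constLabelFunctor.map h)) }
  map f :=
    { app S := Functor.whiskerRight (belowFunctor.flip.map f) (T ⋙ constLabelFunctor.obj S) }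

/-- `T'`: the lifting of `T` to `Set_D`, `T' (X, v) = ∫^S V^S T C^S (X, v)`. -/
noncomputable def liftT (T : Type u ⥤ Type u) : SetD ℒ D ⥤ SetD ℒ D :=
  coendDiagram T ⋙ coendFunctor (ℒ.Substructure D) (SetD ℒ D)

/-- The structure morphisms `V^S T C^S (X, v) ⟶ T' (X, v)` of the coend. -/
noncomputable def liftTι (T : Type u ⥤ Type u) (X : SetD ℒ D) (S : ℒ.Substructure D) :
    (constLabel S).obj (T.obj ((below S).obj X)) ⟶ (liftT T).obj X :=
  coend.ι ((coendDiagram T).obj X) S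

theorem liftTι_map (T : Type u ⥤ Type u) {X Y : SetD ℒ D} (f : X ⟶ Y) (S : ℒ.Substructure D) :
    liftTι T X S ≫ (liftT T).map f =
      (constLabel S).map (T.map ((below S).map f)) ≫ liftTι T Y S :=
  coend.ι_map ((coendDiagram T).map f) S

theorem liftT_hom_ext {T : Type u ⥤ Type u} {X Y : SetD ℒ D} {f g : (liftT T).obj X ⟶ Y}
    (h : ∀ S, liftTι T X S ≫ f = liftTι T X S ≫ g) : f = g :=
  coend.hom_ext h

end Subalgebra

section Skeleton

variable {ℒ : FirstOrder.Language.{a, b}} {D : Type u} [Fintype D] [ℒ.Structure D]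
  [Lattice D] [BoundedOrder D] [BoundedLatticeReduct ℒ D]

variable (ℒ) in
/-- The operation `T_d`, with value `1` at `d` and `0` elsewhere, is term-definable in `D`. -/
theorem exists_indicator_term [SemiPrimal ℒ D] (d : D) : ∃ t : ℒ.Term (Fin 1),
    (∀ x : Fin 1 → D, x 0 = d → t.realize x = ⊤) ∧
      ∀ x : Fin 1 → D, x 0 ≠ d → t.realize x = ⊥ := by
  classical
  obtain ⟨t, ht⟩ := SemiPrimal.exists_term (ℒ := ℒ) (D := D) 1 le_rfl
    (fun x => if x 0 = d then ⊤ else ⊥) (by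
      intro S x _
      have h1 := S.fun_mem (BoundedLatticeReduct.topSym (ℒ := ℒ) (D := D)) (fun i => i.elim0)
        (fun i => i.elim0)
      have h0 := S.fun_mem (BoundedLatticeReduct.botSym (ℒ := ℒ) (D := D)) (fun i => i.elim0)
        (fun i => i.elim0)
      rw [BoundedLatticeReduct.funMap_topSym] at h1
      rw [BoundedLatticeReduct.funMap_botSym] at h0
      split_ifs
      exacts [h1, h0])
  exact ⟨t, fun x hx => by rw [ht, if_pos hx], fun x hx => by rw [ht, if_neg hx]⟩

variable (ℒ) in
/-- A term defining the operation `T_d`. -/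
noncomputable def indicatorTerm [SemiPrimal ℒ D] (d : D) : ℒ.Term (Fin 1) :=
  (exists_indicator_term ℒ d).choose

namespace Variety

variable (A : Variety ℒ D)

/-- The term operation `T_d` on an algebra of the variety. -/
noncomputable def T [SemiPrimal ℒ D] (d : D) (x : A.carrier) : A.carrier :=
  (indicatorTerm ℒ d).realize fun _ => x

/-- The lattice operation `∧` on an algebra of the variety. -/
def inf (x y : A.carrier) : A.carrier :=
  funMap (BoundedLatticeReduct.infSym (ℒ := ℒ) (D := D)) ![x, y]

/-- The lattice operation `∨` on an algebra of the variety. -/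
def sup (x y : A.carrier) : A.carrier :=
  funMap (BoundedLatticeReduct.supSym (ℒ := ℒ) (D := D)) ![x, y]

/-- The constant `0` of an algebra of the variety. -/
def bot : A.carrier := funMap (BoundedLatticeReduct.botSym (ℒ := ℒ) (D := D)) ![]

/-- The constant `1` of an algebra of the variety. -/
def top : A.carrier := funMap (BoundedLatticeReduct.topSym (ℒ := ℒ) (D := D)) ![]

end Variety

/-- The formal operations used to express identities. -/
inductive SkTerm (n : ℕ) : Type
  | var (i : Fin n)
  | inf (s t : SkTerm n)
  | sup (s t : SkTerm n)
  | bot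
  | top
  | T0 (s : SkTerm n)
  | T1 (s : SkTerm n)

open Classical in
/-- Evaluation of formal operations in `D`. -/
noncomputable def SkTerm.evalD {D : Type u} [Lattice D] [BoundedOrder D] {n : ℕ} (x : Fin n → D) :
    SkTerm n → D
  | var i => x i
  | inf s t => s.evalD x ⊓ t.evalD x
  | sup s t => s.evalD x ⊔ t.evalD x
  | bot => ⊥
  | top => ⊤
  | T0 s => if s.evalD x = ⊥ then ⊤ else ⊥
  | T1 s => if s.evalD x = ⊤ then ⊤ else ⊥

variable [SemiPrimal ℒ D]

/-- Evaluation of formal operations in an algebra of the variety. -/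
noncomputable def SkTerm.eval {n : ℕ} (A : Variety ℒ D) (x : Fin n → A.carrier) :
    SkTerm n → A.carrier
  | var i => x i
  | inf s t => A.inf (s.eval A x) (t.eval A x)
  | sup s t => A.sup (s.eval A x) (t.eval A x)
  | bot => A.bot
  | top => A.top
  | T0 s => A.T ⊥ (s.eval A x)
  | T1 s => A.T ⊤ (s.eval A x)

variable (ℒ D) in
/-- Formal operations are terms. -/
noncomputable def SkTerm.toTerm {n : ℕ} : SkTerm n → ℒ.Term (Fin n)
  | var i => .var i
  | inf s t => .func (BoundedLatticeReduct.infSym (ℒ := ℒ) (D := D)) ![s.toTerm, t.toTerm]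
  | sup s t => .func (BoundedLatticeReduct.supSym (ℒ := ℒ) (D := D)) ![s.toTerm, t.toTerm]
  | bot => .func (BoundedLatticeReduct.botSym (ℒ := ℒ) (D := D)) ![]
  | top => .func (BoundedLatticeReduct.topSym (ℒ := ℒ) (D := D)) ![]
  | T0 s => (indicatorTerm ℒ (⊥ : D)).subst fun _ => s.toTerm
  | T1 s => (indicatorTerm ℒ (⊤ : D)).subst fun _ => s.toTerm

theorem SkTerm.realize_toTerm {n : ℕ} (A : Variety ℒ D) (x : Fin n → A.carrier) (t : SkTerm n) :
    (t.toTerm ℒ D).realize x = t.eval A x := by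
  induction t with
  | var i => rfl
  | inf s t hs ht =>
    simp only [toTerm, eval, Term.realize, Variety.inf]
    congr 1
    ext i
    fin_cases i
    · exact hs
    · exact ht
  | sup s t hs ht =>
    simp only [toTerm, eval, Term.realize, Variety.sup]
    congr 1
    ext i
    fin_cases i
    · exact hs
    · exact ht
  | bot =>
    simp only [toTerm, eval, Term.realize, Variety.bot]
    congr 1
    ext i
    exact i.elim0
  | top =>
    simp only [toTerm, eval, Term.realize, Variety.top]
    congr 1
    ext i
    exact i.elim0
  | T0 s hs => simp only [toTerm, eval, Term.realize_subst, hs, Variety.T]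
  | T1 s hs => simp only [toTerm, eval, Term.realize_subst, hs, Variety.T]

namespace Variety

variable {A B : Variety ℒ D}

theorem eval_gen {n : ℕ} (x : Fin n → D) (t : SkTerm n) :
    t.eval (gen : Variety ℒ D) x = t.evalD x := by
  induction t with
  | var i => rfl
  | inf s t hs ht =>
    refine (BoundedLatticeReduct.funMap_infSym (ℒ := ℒ) (D := D) _).trans ?_
    exact congrArg₂ (· ⊓ ·) hs ht
  | sup s t hs ht =>
    refine (BoundedLatticeReduct.funMap_supSym (ℒ := ℒ) (D := D) _).trans ?_
    exact congrArg₂ (· ⊔ ·) hs ht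
  | bot => exact BoundedLatticeReduct.funMap_botSym (ℒ := ℒ) (D := D) _
  | top => exact BoundedLatticeReduct.funMap_topSym (ℒ := ℒ) (D := D) _
  | T0 s hs =>
    simp only [SkTerm.eval, SkTerm.evalD, T]
    rw [hs]
    split_ifs with h
    · exact (exists_indicator_term ℒ ⊥).choose_spec.1 _ h
    · exact (exists_indicator_term ℒ ⊥).choose_spec.2 _ h
  | T1 s hs =>
    simp only [SkTerm.eval, SkTerm.evalD, T]
    rw [hs]
    split_ifs with h
    · exact (exists_indicator_term ℒ ⊤).choose_spec.1 _ h
    · exact (exists_indicator_term ℒ ⊤).choose_spec.2 _ h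

theorem eval_eq {n : ℕ} (s t : SkTerm n) (h : ∀ x : Fin n → D, s.evalD x = t.evalD x)
    (x : Fin n → A.carrier) : s.eval A x = t.eval A x := by
  rw [← SkTerm.realize_toTerm, ← SkTerm.realize_toTerm]
  refine A.mem n _ _ (fun y => ?_) x
  have hs := (SkTerm.realize_toTerm (gen : Variety ℒ D) y s).trans (eval_gen y s)
  have ht := (SkTerm.realize_toTerm (gen : Variety ℒ D) y t).trans (eval_gen y t)
  exact hs.trans ((h y).trans ht.symm)

theorem hom_T (f : A ⟶ B) (d : D) (x : A.carrier) : f.hom (A.T d x) = B.T d (f.hom x) :=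
  (HomClass.realize_term f.hom).symm

theorem hom_eval (f : A ⟶ B) {n : ℕ} (t : SkTerm n) (x : Fin n → A.carrier) :
    f.hom (t.eval A x) = t.eval B (f.hom ∘ x) := by
  rw [← SkTerm.realize_toTerm, ← SkTerm.realize_toTerm, HomClass.realize_term]

theorem hom_inf (f : A ⟶ B) (x y : A.carrier) : f.hom (A.inf x y) = B.inf (f.hom x) (f.hom y) :=
  hom_eval f (.inf (.var 0) (.var 1)) ![x, y]

theorem hom_sup (f : A ⟶ B) (x y : A.carrier) : f.hom (A.sup x y) = B.sup (f.hom x) (f.hom y) :=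
  hom_eval f (.sup (.var 0) (.var 1)) ![x, y]

theorem hom_bot (f : A ⟶ B) : f.hom A.bot = B.bot := hom_eval f (n := 0) .bot ![]

theorem hom_top (f : A ⟶ B) : f.hom A.top = B.top := hom_eval f (n := 0) .top ![]

variable (A) in
/-- The carrier of the Boolean skeleton: the elements `a` with `T_1 a = a`. -/
@[ext]
structure Skel : Type u where
  val : A.carrier
  property : A.T ⊤ val = val

variable [Nontrivial D]

noncomputable instance : Max A.Skel where
  max a b := ⟨A.sup a.1 b.1, by
    have := eval_eq (A := A) (.T1 (.sup (.T1 (.var 0)) (.T1 (.var 1))))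
      (.sup (.T1 (.var 0)) (.T1 (.var 1))) (fun x => by
        by_cases h0 : x 0 = ⊤ <;> by_cases h1 : x 1 = ⊤ <;> simp [SkTerm.evalD, h0, h1]) ![a.1, b.1]
    simpa [SkTerm.eval, a.2, b.2] using this⟩

noncomputable instance : Min A.Skel where
  min a b := ⟨A.inf a.1 b.1, by
    have := eval_eq (A := A) (.T1 (.inf (.T1 (.var 0)) (.T1 (.var 1))))
      (.inf (.T1 (.var 0)) (.T1 (.var 1))) (fun x => by
        by_cases h0 : x 0 = ⊤ <;> by_cases h1 : x 1 = ⊤ <;> simp [SkTerm.evalD, h0, h1]) ![a.1, b.1]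
    simpa [SkTerm.eval, a.2, b.2] using this⟩

noncomputable instance : Top A.Skel where
  top := ⟨A.top, eval_eq (A := A) (n := 0) (.T1 .top) .top (fun x => by simp [SkTerm.evalD]) ![]⟩

noncomputable instance : Bot A.Skel where
  bot := ⟨A.bot, eval_eq (A := A) (n := 0) (.T1 .bot) .bot (fun x => by simp [SkTerm.evalD]) ![]⟩

noncomputable instance : Compl A.Skel where
  compl a := ⟨A.T ⊥ a.1, eval_eq (A := A) (.T1 (.T0 (.var 0))) (.T0 (.var 0)) (fun x => by
    simp only [SkTerm.evalD]
    split_ifs <;> simp_all) ![a.1]⟩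

/-- The lattice structure of the Boolean skeleton, inherited from the algebra. -/
noncomputable instance : Lattice A.Skel :=
  Lattice.mk'
    (fun a b => Skel.ext <| eval_eq (A := A) (.sup (.var 0) (.var 1)) (.sup (.var 1) (.var 0))
      (fun x => by simp only [SkTerm.evalD, sup_comm]) ![a.1, b.1])
    (fun a b c => Skel.ext <| eval_eq (A := A) (.sup (.sup (.var 0) (.var 1)) (.var 2))
      (.sup (.var 0) (.sup (.var 1) (.var 2)))
      (fun x => by simp only [SkTerm.evalD, sup_assoc]) ![a.1, b.1, c.1])
    (fun a b => Skel.ext <| eval_eq (A := A) (.inf (.var 0) (.var 1)) (.inf (.var 1) (.var 0))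
      (fun x => by simp only [SkTerm.evalD, inf_comm]) ![a.1, b.1])
    (fun a b c => Skel.ext <| eval_eq (A := A) (.inf (.inf (.var 0) (.var 1)) (.var 2))
      (.inf (.var 0) (.inf (.var 1) (.var 2)))
      (fun x => by simp only [SkTerm.evalD, inf_assoc]) ![a.1, b.1, c.1])
    (fun a b => Skel.ext <| eval_eq (A := A) (.sup (.var 0) (.inf (.var 0) (.var 1))) (.var 0)
      (fun x => by simp [SkTerm.evalD]) ![a.1, b.1])
    (fun a b => Skel.ext <| eval_eq (A := A) (.inf (.var 0) (.sup (.var 0) (.var 1))) (.var 0)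
      (fun x => by simp [SkTerm.evalD]) ![a.1, b.1])

/-- The Boolean skeleton is a Boolean algebra, with negation `T_0`. -/
noncomputable instance : BooleanAlgebra A.Skel where
  __ := (inferInstance : Lattice A.Skel)
  le_sup_inf a b c := by
    rw [← sup_eq_right]
    have := eval_eq (A := A)
      (.sup (.inf (.sup (.T1 (.var 0)) (.T1 (.var 1))) (.sup (.T1 (.var 0)) (.T1 (.var 2))))
        (.sup (.T1 (.var 0)) (.inf (.T1 (.var 1)) (.T1 (.var 2)))))
      (.sup (.T1 (.var 0)) (.inf (.T1 (.var 1)) (.T1 (.var 2)))) (fun x => by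
        by_cases h0 : x 0 = ⊤ <;> by_cases h1 : x 1 = ⊤ <;> by_cases h2 : x 2 = ⊤ <;>
          simp [SkTerm.evalD, h0, h1, h2]) ![a.1, b.1, c.1]
    simp only [SkTerm.eval, Matrix.cons_val, a.2, b.2, c.2] at this
    exact Skel.ext this
  compl := compl
  top := ⊤
  bot := ⊥
  inf_compl_le_bot a := by
    rw [← sup_eq_right]
    have := eval_eq (A := A) (.sup (.inf (.T1 (.var 0)) (.T0 (.T1 (.var 0)))) .bot) .bot (fun x => by
        simp only [SkTerm.evalD]
        split_ifs <;> simp_all) ![a.1]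
    simp only [SkTerm.eval, Matrix.cons_val, a.2] at this
    exact Skel.ext this
  top_le_sup_compl a := by
    rw [← sup_eq_right]
    have := eval_eq (A := A) (.sup .top (.sup (.T1 (.var 0)) (.T0 (.T1 (.var 0)))))
      (.sup (.T1 (.var 0)) (.T0 (.T1 (.var 0)))) (fun x => by
        simp only [SkTerm.evalD]
        split_ifs <;> simp_all) ![a.1]
    simp only [SkTerm.eval, Matrix.cons_val, a.2] at this
    exact Skel.ext this
  le_top a := by
    rw [← sup_eq_right]
    exact Skel.ext <| eval_eq (A := A) (.sup (.var 0) .top) .top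
      (fun x => by simp [SkTerm.evalD]) ![a.1]
  bot_le a := by
    rw [← sup_eq_right]
    exact Skel.ext <| eval_eq (A := A) (.sup .bot (.var 0)) (.var 0)
      (fun x => by simp [SkTerm.evalD]) ![a.1]

end Variety

/-- `𝔖`: the Boolean skeleton functor; homomorphisms are restricted. -/
noncomputable def skeleton [Nontrivial D] : Variety ℒ D ⥤ BoolAlg.{u} where
  obj A := BoolAlg.of A.Skel
  map {A B} f := BoolAlg.ofHom
    { toFun a := (⟨f.hom a.1, by rw [← Variety.hom_T, a.2]⟩ : B.Skel)
      map_sup' a b := Variety.Skel.ext (Variety.hom_sup f a.1 b.1)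
      map_inf' a b := Variety.Skel.ext (Variety.hom_inf f a.1 b.1)
      map_top' := Variety.Skel.ext (Variety.hom_top f)
      map_bot' := Variety.Skel.ext (Variety.hom_bot f) }

end Skeleton

section Quotient

variable {ℒ : FirstOrder.Language.{a, b}} [ℒ.IsAlgebraic] {D : Type u} [ℒ.Structure D]

namespace Variety

variable (A : Variety ℒ D) (S : ℒ.Substructure D)

/-- The congruence identifying two elements when all homomorphisms from the algebra to `D` with
image contained in `S` agree on them. -/
def congr : Setoid A.carrier where
  r x y := ∀ u : A.carrier →[ℒ] D, u.range ≤ S → u x = u y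
  iseqv := ⟨fun _ _ _ => rfl, fun h u hu => (h u hu).symm,
    fun h h' u hu => (h u hu).trans (h' u hu)⟩

instance : ℒ.Prestructure (A.congr S) where
  toStructure := A.str
  fun_equiv {n φ} x y h := by
    intro u hu
    refine (u.map_fun φ x).trans (Eq.trans ?_ (u.map_fun φ y).symm)
    congr 1
    ext i
    exact h i u hu
  rel_equiv {n r} := (IsEmpty.false r).elim

/-- The quotient map. -/
def quotMk : A.carrier →[ℒ] Quotient (A.congr S) :=
  homOfFun (fun x => Quotient.mk _ x) fun _ φ x => (funMap_quotient_mk' _ φ x).symm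

/-- The quotient of the algebra by the congruence above. -/
def quot : Variety ℒ D where
  carrier := Quotient (A.congr S)
  mem := .of_surjective A.mem (A.quotMk S) Quotient.exists_rep

variable {A S}

/-- Homomorphisms into quotients, from homomorphisms which are compatible with the congruences. -/
def quotLift {B : Variety ℒ D} {R : ℒ.Substructure D} (f : A ⟶ B)
    (hf : ∀ x y, (A.congr S) x y → (B.congr R) (f.hom x) (f.hom y)) : A.quot S ⟶ B.quot R :=
  ⟨homOfFun (A := Quotient (A.congr S)) (B := Quotient (B.congr R))
    (Quotient.map f.hom hf) fun n φ x => by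
      obtain ⟨y, rfl⟩ : ∃ y : Fin n → A.carrier, x = fun i => Quotient.mk _ (y i) :=
        ⟨fun i => (x i).out, by ext i; exact (Quotient.out_eq _).symm⟩
      refine (congrArg (Quotient.map f.hom hf) (funMap_quotient_mk' (A.congr S) φ y)).trans ?_
      refine Eq.trans ?_ (funMap_quotient_mk' (B.congr R) φ fun i => f.hom (y i)).symm
      exact congrArg (Quotient.mk _) (Variety.hom_funMap f φ y)⟩

end Variety

/-- The functor sending an algebra to its quotient determined by `S`. -/
def quotFunctor (S : ℒ.Substructure D) : Variety ℒ D ⥤ Variety ℒ D where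
  obj A := A.quot S
  map {A B} f := Variety.quotLift f fun x y h u hu => h (u.comp f.hom) (by
    rintro _ ⟨z, rfl⟩
    exact hu ⟨f.hom z, rfl⟩)
  map_id A := by
    ext x
    obtain ⟨x, rfl⟩ := Quotient.exists_rep x
    rfl
  map_comp f g := by
    ext x
    obtain ⟨x, rfl⟩ := Quotient.exists_rep x
    rfl

/-- For `S₁ ≤ S₂`, the quotient determined by `S₁` is a quotient of the one determined by `S₂`;
so these functors depend contravariantly on `S`. -/
def quotSystem : (ℒ.Substructure D)ᵒᵖ ⥤ Variety ℒ D ⥤ Variety ℒ D where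
  obj S := quotFunctor S.unop
  map h :=
    { app A := Variety.quotLift (𝟙 A) fun x y hxy u hu => hxy u (hu.trans h.unop.le)
      naturality A B f := by
        ext x
        obtain ⟨x, rfl⟩ := Quotient.exists_rep x
        rfl }
  map_id S := by
    ext A x
    obtain ⟨x, rfl⟩ := Quotient.exists_rep x
    rfl
  map_comp f g := by
    ext A x
    obtain ⟨x, rfl⟩ := Quotient.exists_rep x
    rfl

/-- `K_S`: the Boolean skeleton of the quotient determined by `S`, functorially in `S`. -/
noncomputable def skeletonBelow [Fintype D] [Lattice D] [BoundedOrder D] [BoundedLatticeReduct ℒ D]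
    [SemiPrimal ℒ D] [Nontrivial D] : (ℒ.Substructure D)ᵒᵖ ⥤ Variety ℒ D ⥤ BoolAlg.{u} :=
  quotSystem ⋙ (Functor.whiskeringRight _ _ _).obj skeleton

end Quotient

section BooleanPower

variable {ℒ : FirstOrder.Language.{a, b}} {D : Type u} [Fintype D] [ℒ.Structure D]

/-- The carrier of the Boolean power `S[B]` of a finite algebra `S ≤ D`: families `ξ` of pairwise
disjoint elements of `B` with join `1`, indexed by `S`. Such families are extended to all of `D`
by `0`, so that for `S₁ ≤ S₂` the embedding `S₁[B] → S₂[B]` is an inclusion. -/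
@[ext]
structure BoolPow (S : ℒ.Substructure D) (B : Type u) [BooleanAlgebra B] : Type u where
  val : D → B
  eq_bot : ∀ d, d ∉ S → val d = ⊥
  disjoint : ∀ d e, d ≠ e → val d ⊓ val e = ⊥
  sup_eq : Finset.univ.sup val = ⊤

namespace BoolPow

variable {S : ℒ.Substructure D} {B : Type u} [BooleanAlgebra B]

/-- The meet `ξ₁(x₁) ∧ ⋯ ∧ ξₙ(xₙ)`. -/
def atom {n : ℕ} (ξ : Fin n → BoolPow S B) (x : Fin n → D) : B :=
  Finset.univ.inf fun i => (ξ i).1 (x i)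

theorem atom_le {n : ℕ} (ξ : Fin n → BoolPow S B) (x : Fin n → D) (i : Fin n) :
    atom ξ x ≤ (ξ i).1 (x i) := Finset.inf_le (f := fun i => (ξ i).1 (x i)) (Finset.mem_univ i)

theorem atom_disjoint {n : ℕ} (ξ : Fin n → BoolPow S B) {x y : Fin n → D} (h : x ≠ y) :
    atom ξ x ⊓ atom ξ y = ⊥ := by
  obtain ⟨i, hi⟩ := Function.ne_iff.1 h
  exact le_bot_iff.1 ((inf_le_inf (atom_le ξ x i) (atom_le ξ y i)).trans
    ((ξ i).disjoint _ _ hi).le)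

theorem atom_sup {n : ℕ} (ξ : Fin n → BoolPow S B) : Finset.univ.sup (atom ξ) = ⊤ := by
  classical
  have h := Finset.inf_sup (Finset.univ : Finset (Fin n)) (fun _ => (Finset.univ : Finset D))
    (fun i d => (ξ i).1 d)
  have h' : (Finset.univ.inf fun i : Fin n => Finset.univ.sup fun d => (ξ i).1 d) = ⊤ := by
    rw [Finset.inf_eq_top_iff]
    exact fun i _ => (ξ i).sup_eq
  rw [h'] at h
  rw [eq_top_iff, h]
  refine Finset.sup_le fun g _ => ?_
  refine le_trans ?_ (Finset.le_sup (f := atom ξ) (Finset.mem_univ fun i => g i (Finset.mem_univ i)))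
  exact Finset.le_inf fun i _ => Finset.inf_le
    (f := fun i : {i // i ∈ (Finset.univ : Finset (Fin n))} => (ξ i.1).1 (g i.1 i.2))
    (Finset.mem_attach _ ⟨i, Finset.mem_univ i⟩)

open Classical in
/-- The operations of the Boolean power, `φ(ξ₁, …, ξₙ)(d) = ⋁ {ξ₁(x₁) ∧ ⋯ ∧ ξₙ(xₙ) | φ(x) = d}`. -/
noncomputable instance : ℒ.Structure (BoolPow S B) where
  funMap {n} φ ξ := ⟨fun d => (Finset.univ.filter fun x : Fin n → D => funMap φ x = d).sup (atom ξ),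
    fun d hd => by
      rw [Finset.sup_eq_bot_iff]
      intro x hx
      rw [Finset.mem_filter] at hx
      obtain ⟨i, hi⟩ : ∃ i, x i ∉ S := by
        by_contra! h
        exact hd (hx.2 ▸ S.fun_mem φ x h)
      exact le_bot_iff.1 ((atom_le ξ x i).trans ((ξ i).eq_bot _ hi).le),
    fun d e hde => by
      rw [Finset.sup_inf_sup, Finset.sup_eq_bot_iff]
      rintro ⟨x, y⟩ h
      simp only [Finset.mem_product, Finset.mem_filter, Finset.mem_univ, true_and] at h
      refine atom_disjoint ξ fun hxy => hde ?_
      exact h.1.symm.trans ((congrArg _ hxy).trans h.2),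
    by
      rw [eq_top_iff, ← atom_sup ξ]
      refine Finset.sup_le fun x _ => ?_
      refine le_trans ?_ (Finset.le_sup (Finset.mem_univ (funMap φ x)))
      exact Finset.le_sup (f := atom ξ) (by simp)⟩
  RelMap _ _ := False

theorem le_funMap {n : ℕ} (φ : ℒ.Functions n) (ξ : Fin n → BoolPow S B) (x : Fin n → D) :
    atom ξ x ≤ (funMap φ ξ).1 (funMap φ x) :=
  Finset.le_sup (f := atom ξ) (by simp)

theorem le_realize {n : ℕ} (ξ : Fin n → BoolPow S B) (x : Fin n → D) (t : ℒ.Term (Fin n)) :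
    atom ξ x ≤ (t.realize ξ).1 (t.realize x) := by
  induction t with
  | var i => exact atom_le ξ x i
  | func φ ts ih => exact le_trans (Finset.le_inf fun i _ => ih i) (le_funMap φ _ _)

theorem ext_of_le {ξ ζ : BoolPow S B} (h : ∀ d, ξ.1 d ≤ ζ.1 d) : ξ = ζ := by
  refine BoolPow.ext (funext fun d => le_antisymm (h d) ?_)
  have : ζ.1 d = ζ.1 d ⊓ Finset.univ.sup ξ.1 := by rw [ξ.sup_eq, inf_top_eq]
  rw [this, Finset.sup_inf_distrib_left]
  refine Finset.sup_le fun e _ => ?_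
  by_cases hde : d = e
  · exact hde ▸ inf_le_right
  · exact (inf_le_inf le_rfl (h e)).trans ((ζ.disjoint _ _ hde).le.trans bot_le)

theorem mem_variety (S : ℒ.Substructure D) (B : Type u) [BooleanAlgebra B] :
    InVariety ℒ D (BoolPow S B) := by
  intro n s t hst ξ
  refine ext_of_le fun d => ?_
  have : (s.realize ξ).1 d = (s.realize ξ).1 d ⊓ Finset.univ.sup (atom ξ) := by
    rw [atom_sup, inf_top_eq]
  rw [this, Finset.sup_inf_distrib_left]
  refine Finset.sup_le fun x _ => ?_
  by_cases hd : d = s.realize x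
  · rw [hd, hst x]
    exact inf_le_right.trans (le_realize ξ x t)
  · exact (inf_le_inf le_rfl (le_realize ξ x s)).trans
      (((s.realize ξ).disjoint _ _ hd).le.trans bot_le)

end BoolPow

/-- The label `s` of a point `y` for which `y ∈ ξ s`. -/
theorem BoolPow.existsUnique_mem {S : ℒ.Substructure D} {Y : Type u} (ξ : BoolPow S (Set Y))
    (y : Y) : ∃! d, y ∈ ξ.1 d := by
  have h : y ∈ Finset.univ.sup ξ.1 := by rw [ξ.sup_eq]; trivial
  rw [Finset.sup_eq_iSup] at h
  simp only [Set.iSup_eq_iUnion, Set.mem_iUnion] at h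
  obtain ⟨d, _, hd⟩ := h
  refine ⟨d, hd, fun e he => ?_⟩
  by_contra hne
  have := ξ.disjoint e d hne
  exact (this ▸ (⟨he, hd⟩ : y ∈ ξ.1 e ⊓ ξ.1 d) : y ∈ (⊥ : Set Y))

/-- The value at `y` of the function corresponding to `ξ`: the unique `d` with `y ∈ ξ d`. -/
noncomputable def BoolPow.value {S : ℒ.Substructure D} {Y : Type u} (ξ : BoolPow S (Set Y))
    (y : Y) : D := (ξ.existsUnique_mem y).choose

theorem BoolPow.value_eq_iff {S : ℒ.Substructure D} {Y : Type u} (ξ : BoolPow S (Set Y))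
    (y : Y) (d : D) : ξ.value y = d ↔ y ∈ ξ.1 d :=
  ⟨fun h => h ▸ (ξ.existsUnique_mem y).choose_spec.1,
    fun h => ((ξ.existsUnique_mem y).choose_spec.2 d h).symm⟩

theorem BoolPow.value_funMap {S : ℒ.Substructure D} {Y : Type u} {n : ℕ} (φ : ℒ.Functions n)
    (ξ : Fin n → BoolPow S (Set Y)) (y : Y) :
    (funMap φ ξ).value y = funMap φ fun i => (ξ i).value y := by
  rw [BoolPow.value_eq_iff]
  refine (BoolPow.le_funMap φ ξ fun i => (ξ i).value y) ?_
  have h : y ∈ ⨅ i ∈ Finset.univ, (ξ i).1 ((ξ i).value y) := by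
    simp only [Set.iInf_eq_iInter, Set.mem_iInter]
    exact fun i _ => ((ξ i).value_eq_iff y _).1 rfl
  rw [← Finset.inf_eq_iInf] at h
  exact h

variable [ℒ.IsAlgebraic]

/-- The Boolean power `S[B]`, as an algebra of the variety. -/
noncomputable def boolPowObj (S : ℒ.Substructure D) (B : BoolAlg.{u}) : Variety ℒ D where
  carrier := BoolPow S B
  mem := BoolPow.mem_variety S B

/-- The homomorphism `S[B] → S[C]` induced by a homomorphism `h : B → C`, `ξ ↦ h ∘ ξ`. -/
noncomputable def boolPowMap (S : ℒ.Substructure D) {B C : BoolAlg.{u}} (h : B ⟶ C) :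
    boolPowObj S B ⟶ boolPowObj S C :=
  ⟨homOfFun (A := BoolPow S B) (B := BoolPow S C) (fun ξ => ⟨fun d => h.hom (ξ.1 d),
      fun d hd => by rw [ξ.eq_bot d hd, map_bot],
      fun d e hde => by rw [← map_inf, ξ.disjoint d e hde, map_bot],
      (map_finset_sup h.hom _ ξ.1).symm.trans (by rw [ξ.sup_eq, map_top])⟩)
    fun n φ ξ => BoolPow.ext (funext fun d => (map_finset_sup h.hom _ _).trans
      (Finset.sup_congr rfl fun x _ => map_finset_inf h.hom _ _))⟩

/-- The inclusion `S₁[B] → S₂[B]` for `S₁ ≤ S₂`. -/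
noncomputable def boolPowIncl {S₁ S₂ : ℒ.Substructure D} (hS : S₁ ≤ S₂) (B : BoolAlg.{u}) :
    boolPowObj S₁ B ⟶ boolPowObj S₂ B :=
  ⟨homOfFun (A := BoolPow S₁ B) (B := BoolPow S₂ B)
    (fun ξ => ⟨ξ.1, fun d hd => ξ.eq_bot d fun h => hd (hS h), ξ.disjoint, ξ.sup_eq⟩) fun _ _ _ => rfl⟩

/-- `𝔓_S`: the Boolean power functor `B ↦ S[B]`, functorially in `S`. -/
noncomputable def boolPower : ℒ.Substructure D ⥤ BoolAlg.{u} ⥤ Variety ℒ D where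
  obj S :=
    { obj := boolPowObj S
      map := boolPowMap S
      map_id _ := rfl
      map_comp _ _ := rfl }
  map h :=
    { app := boolPowIncl h.le
      naturality _ _ _ := rfl }
  map_id _ := rfl
  map_comp _ _ := rfl

variable [Lattice D] [BoundedOrder D] [BoundedLatticeReduct ℒ D] [SemiPrimal ℒ D] [Nontrivial D]

/-- The diagram `(S, R) ↦ 𝔓_S L K_R A`, functorially in `A`. -/
noncomputable def endDiagram (L : BoolAlg.{u} ⥤ BoolAlg.{u}) :
    Variety ℒ D ⥤ (ℒ.Substructure D)ᵒᵖ ⥤ ℒ.Substructure D ⥤ Variety ℒ D where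
  obj A := skeletonBelow.flip.obj A ⋙ L ⋙ boolPower.flip
  map f := Functor.whiskerRight (skeletonBelow.flip.map f) (L ⋙ boolPower.flip)

/-- `L'`: the lifting of `L` to the variety generated by `D`, `L' A = ∫_S 𝔓_S L K_S A`. -/
noncomputable def liftL (L : BoolAlg.{u} ⥤ BoolAlg.{u}) : Variety ℒ D ⥤ Variety ℒ D :=
  endDiagram L ⋙ endFunctor (ℒ.Substructure D) (Variety ℒ D)

/-- The structure morphisms `L' A ⟶ 𝔓_S L K_S A` of the end. -/
noncomputable def liftLπ (L : BoolAlg.{u} ⥤ BoolAlg.{u}) (A : Variety ℒ D)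
    (S : ℒ.Substructure D) :
    (liftL L).obj A ⟶ boolPowObj S (L.obj ((skeletonBelow.obj (op S)).obj A)) :=
  end_.π ((endDiagram L).obj A) S

theorem liftLπ_condition (L : BoolAlg.{u} ⥤ BoolAlg.{u}) (A : Variety ℒ D)
    {S₁ S₂ : ℒ.Substructure D} (h : S₁ ⟶ S₂) :
    liftLπ L A S₁ ≫ boolPowIncl h.le (L.obj ((skeletonBelow.obj (op S₁)).obj A)) =
      liftLπ L A S₂ ≫ boolPowMap S₂ (L.map ((skeletonBelow.map h.op).app A)) :=
  end_.condition ((endDiagram L).obj A) h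

theorem map_liftLπ (L : BoolAlg.{u} ⥤ BoolAlg.{u}) {A B : Variety ℒ D} (f : A ⟶ B)
    (S : ℒ.Substructure D) : (liftL L).map f ≫ liftLπ L B S =
      liftLπ L A S ≫ boolPowMap S (L.map ((skeletonBelow.obj (op S)).map f)) :=
  end_.map_π ((endDiagram L).map f) S

/-- The natural isomorphism `𝔓_S P Y ≅ P' V^S Y`, as a homomorphism; it sends `ξ` to the function `α` with `α y = s` iff
`y ∈ ξ s`. -/
noncomputable def powerComparison (S : ℒ.Substructure D) (Y : Type u) :
    boolPowObj S (powersetFunctor.obj (op Y)) ⟶ ((constLabel S).obj Y).prod :=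
  ⟨homOfFun (A := BoolPow S (Set Y)) (B := ((constLabel S).obj Y).Prod)
    (fun ξ => ⟨ξ.value, fun y => by
      by_contra h
      have h1 := (ξ.value_eq_iff y _).1 rfl
      rw [ξ.eq_bot _ h] at h1
      exact h1⟩) fun n φ ξ => SetD.Prod.ext (funext fun y => BoolPow.value_funMap φ ξ y)⟩

/-- Evaluation at a point of `C^S (X, v)`, as a homomorphism from the quotient of `P' (X, v)`
determined by `S`. -/
def SetD.quotEval (X : SetD ℒ D) (S : ℒ.Substructure D) (x : X.Below S) :
    X.prod.quot S ⟶ .gen :=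
  ⟨homOfFun (A := Quotient (X.prod.congr S)) (B := D)
    (Quotient.lift (X.eval x.1) fun α β h => h (X.eval x.1) (by
      rintro _ ⟨α, rfl⟩
      exact x.2 (SetD.Prod.property α x.1)))
    fun n φ α => by
      obtain ⟨β, rfl⟩ : ∃ β : Fin n → X.Prod, α = fun i => Quotient.mk (X.prod.congr S) (β i) :=
        ⟨fun i => (α i).out, by ext i; exact (Quotient.out_eq _).symm⟩
      refine (congrArg (Quotient.lift (X.eval x.1) _)
        (funMap_quotient_mk' (X.prod.congr S) φ β)).trans ?_
      exact (X.eval x.1).map_fun φ β⟩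

theorem Variety.skel_eval {A : Variety ℒ D} (u : A ⟶ .gen) (p : A.Skel) :
    u.hom p.1 = (⊤ : D) ∨ u.hom p.1 = (⊥ : D) := by
  have h : (u.hom p.1 : D) = (SkTerm.T1 (.var 0)).evalD fun _ : Fin 1 => (u.hom p.1 : D) :=
    ((congrArg u.hom p.2.symm).trans (Variety.hom_T u ⊤ p.1)).trans
      (Variety.eval_gen (ℒ := ℒ) (n := 1) (fun _ => (u.hom p.1 : D)) (.T1 (.var 0)))
  generalize (u.hom p.1 : D) = d at h ⊢
  by_cases hd : d = ⊤
  · exact Or.inl hd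
  · exact Or.inr (h.trans (if_neg hd))

/-- The natural isomorphism `K_S P' (X, v) ≅ P C^S (X, v)`, as a homomorphism; it sends the class of
`α` (with values `0` and `1` on `C^S (X, v)`) to the set of all `x` in `C^S (X, v)` with
`α x = 1`. -/
noncomputable def skeletonComparison (S : ℒ.Substructure D) (X : SetD ℒ D) :
    (skeletonBelow.obj (op S)).obj X.prod ⟶ powersetFunctor.obj (op ((below S).obj X)) :=
  BoolAlg.ofHom (X := (X.prod.quot S).Skel) (Y := Set (X.Below S))
    { toFun p := {x | (X.quotEval S x).hom p.1 = (⊤ : D)}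
      map_sup' p q := Set.ext fun x => by
        have hp := Variety.skel_eval (X.quotEval S x) p
        have hq := Variety.skel_eval (X.quotEval S x) q
        have h : ((X.quotEval S x).hom (p ⊔ q).1 : D) =
            (X.quotEval S x).hom p.1 ⊔ (X.quotEval S x).hom q.1 :=
          (Variety.hom_sup (X.quotEval S x) p.1 q.1).trans
            (Variety.eval_gen (ℒ := ℒ) (n := 2) ![_, _] (.sup (.var 0) (.var 1)))
        change ((X.quotEval S x).hom (p ⊔ q).1 : D) = ⊤ ↔
          ((X.quotEval S x).hom p.1 : D) = ⊤ ∨ ((X.quotEval S x).hom q.1 : D) = ⊤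
        rw [h]
        generalize ((X.quotEval S x).hom p.1 : D) = d at hp ⊢
        generalize ((X.quotEval S x).hom q.1 : D) = e at hq ⊢
        rcases hp with rfl | rfl <;> rcases hq with rfl | rfl <;> simp
      map_inf' p q := Set.ext fun x => by
        have h : ((X.quotEval S x).hom (p ⊓ q).1 : D) =
            (X.quotEval S x).hom p.1 ⊓ (X.quotEval S x).hom q.1 :=
          (Variety.hom_inf (X.quotEval S x) p.1 q.1).trans
            (Variety.eval_gen (ℒ := ℒ) (n := 2) ![_, _] (.inf (.var 0) (.var 1)))
        change ((X.quotEval S x).hom (p ⊓ q).1 : D) = ⊤ ↔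
          ((X.quotEval S x).hom p.1 : D) = ⊤ ∧ ((X.quotEval S x).hom q.1 : D) = ⊤
        rw [h, inf_eq_top_iff]
      map_top' := Set.ext fun x => iff_of_true ((Variety.hom_top (X.quotEval S x)).trans
        (Variety.eval_gen (ℒ := ℒ) (n := 0) ![] .top)) trivial
      map_bot' := Set.ext fun x => iff_of_false (fun h => bot_ne_top (α := D) <|
        ((Variety.hom_bot (X.quotEval S x)).trans
          (Variety.eval_gen (ℒ := ℒ) (n := 0) ![] .bot)).symm.trans h) id }

end BooleanPower

section Logic

variable {C : Type*} [Category* C] {V : Type*} [Category* V]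

/-- An abstract coalgebraic logic for `T : C ⥤ C` over the dual adjunction `S ⊣ P` between `C` and
`V`: an endofunctor `L` of `V` and a natural transformation `δ : L P ⟶ P T`. -/
structure AbstractCoalgebraicLogic {S : V ⥤ Cᵒᵖ} {P : Cᵒᵖ ⥤ V} (adj : S ⊣ P) (T : C ⥤ C) where
  L : V ⥤ V
  δ : P ⋙ L ⟶ T.op ⋙ P

namespace AbstractCoalgebraicLogic

variable {S : V ⥤ Cᵒᵖ} {P : Cᵒᵖ ⥤ V} {adj : S ⊣ P} {T : C ⥤ C}
  (Λ : AbstractCoalgebraicLogic adj T)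

/-- One-step completeness: `δ` is a (componentwise) monomorphism. -/
def OneStepComplete : Prop := ∀ X, Mono (Λ.δ.app X)

/-- The components `T S A ⟶ S P T S A ⟶ S L P S A ⟶ S L A` of the adjoint transpose of `δ`. -/
def transpose (A : V) : T.obj (S.obj A).unop ⟶ (S.obj (Λ.L.obj A)).unop :=
  (adj.counit.app (op (T.obj (S.obj A).unop))).unop ≫
    (S.map (Λ.δ.app (S.obj A))).unop ≫ (S.map (Λ.L.map (adj.unit.app A))).unop

/-- Expressivity, with respect to a class `M` of monomorphisms and a class `E` of epimorphisms
which form a factorization system. -/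
structure Expressive (M E : MorphismProperty C) : Prop where
  hasInitial : HasInitial (Endofunctor.Algebra Λ.L)
  le_monomorphisms : M ≤ .monomorphisms C
  le_epimorphisms : E ≤ .epimorphisms C
  hasFactorization : E.HasFactorization M
  hasLiftingProperty : ∀ {A B X Y : C} (e : A ⟶ B) (m : X ⟶ Y), E e → M m → HasLiftingProperty e m
  map_mem : ∀ {X Y : C} (m : X ⟶ Y), M m → M (T.map m)
  transpose_mem : ∀ A, M (Λ.transpose A)

end AbstractCoalgebraicLogic

end Logic

section Lifting

variable {ℒ : FirstOrder.Language.{a, b}} [ℒ.IsAlgebraic] {D : Type u} [Fintype D] [ℒ.Structure D]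
  [Lattice D] [BoundedOrder D] [BoundedLatticeReduct ℒ D] [SemiPrimal ℒ D] [Nontrivial D]

theorem powerComparison_naturality (S : ℒ.Substructure D) {Y Z : Type u} (f : Y ⟶ Z) :
    boolPowMap S (powersetFunctor.map f.op) ≫ powerComparison S Y =
      powerComparison S Z ≫ SetD.precomp ((constLabel S).map f) := by
  ext (ξ : BoolPow S (Set Z))
  refine SetD.Prod.ext (funext fun y => ?_)
  exact (BoolPow.value_eq_iff _ _ _).2 ((ξ.value_eq_iff (f y) _).1 rfl)

theorem powerComparison_incl {S₁ S₂ : ℒ.Substructure D} (h : S₁ ≤ S₂) (Y : Type u) :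
    boolPowIncl h (powersetFunctor.obj (op Y)) ≫ powerComparison S₂ Y =
      powerComparison S₁ Y ≫ SetD.precomp ((constLabelMap h).app Y) := rfl

theorem skeletonComparison_naturality (S : ℒ.Substructure D) {X Y : SetD ℒ D} (f : X ⟶ Y) :
    ((skeletonBelow.obj (op S)).map (SetD.precomp f)) ≫ skeletonComparison S X =
      skeletonComparison S Y ≫ powersetFunctor.map ((below S).map f).op := by
  ext ⟨q, hq⟩
  obtain ⟨q, rfl⟩ := Quotient.exists_rep q
  rfl

theorem skeletonComparison_incl {S₁ S₂ : ℒ.Substructure D} (h : S₁ ⟶ S₂) (X : SetD ℒ D) :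
    (skeletonBelow.map h.op).app X.prod ≫ skeletonComparison S₁ X =
      skeletonComparison S₂ X ≫ powersetFunctor.map ((belowMap h.le).app X).op := by
  ext ⟨q, hq⟩
  obtain ⟨q, rfl⟩ := Quotient.exists_rep q
  rfl

variable {T : Type u ⥤ Type u} {L : BoolAlg.{u} ⥤ BoolAlg.{u}}
  (δ : powersetFunctor ⋙ L ⟶ T.op ⋙ powersetFunctor)

theorem boolPowMap_comp (S : ℒ.Substructure D) {A B C : BoolAlg.{u}} (f : A ⟶ B) (g : B ⟶ C) :
    boolPowMap S (f ≫ g) = boolPowMap S f ≫ boolPowMap S g := rfl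

theorem boolPowMap_incl {S₁ S₂ : ℒ.Substructure D} (h : S₁ ≤ S₂) {B C : BoolAlg.{u}}
    (f : B ⟶ C) : boolPowMap S₁ f ≫ boolPowIncl h C = boolPowIncl h B ≫ boolPowMap S₂ f := rfl

/-- The composite
`𝔓_S L K_S P' (X, v) ≅ 𝔓_S L P C^S (X, v) ⟶ 𝔓_S P T C^S (X, v) ≅ P' V^S T C^S (X, v)`
with second map `𝔓_S δ`. -/
noncomputable def liftStep (X : SetD ℒ D) (S : ℒ.Substructure D) :
    boolPowObj S (L.obj ((skeletonBelow.obj (op S)).obj X.prod)) ⟶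
      ((constLabel S).obj (T.obj ((below S).obj X))).prod :=
  boolPowMap S (L.map (skeletonComparison S X)) ≫ boolPowMap S (δ.app (op ((below S).obj X))) ≫
    powerComparison S (T.obj ((below S).obj X))

/-- The wedge `L' P' (X, v) ⟶ 𝔓_S L K_S P' (X, v) ⟶ P' V^S T C^S (X, v)`. -/
noncomputable def liftWedge (X : SetD ℒ D) (S : ℒ.Substructure D) :
    (liftL L).obj X.prod ⟶ ((constLabel S).obj (T.obj ((below S).obj X))).prod :=
  liftLπ L X.prod S ≫ liftStep δ X S

/-- Naturality of the right part of `liftStep`, for maps of sets. -/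
theorem liftStep_aux (S : ℒ.Substructure D) {K K' : BoolAlg.{u}} {W Z : Type u} (b : W ⟶ Z)
    (k : K' ⟶ powersetFunctor.obj (op Z)) (k' : K ⟶ powersetFunctor.obj (op W)) (c : K' ⟶ K)
    (h : c ≫ k' = k ≫ powersetFunctor.map b.op) :
    boolPowMap S (L.map c) ≫ boolPowMap S (L.map k') ≫ boolPowMap S (δ.app (op W)) ≫
        powerComparison S (T.obj W) =
      (boolPowMap S (L.map k) ≫ boolPowMap S (δ.app (op Z)) ≫ powerComparison S (T.obj Z)) ≫
        SetD.precomp ((constLabel S).map (T.map b)) := by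
  have hδ : L.map c ≫ L.map k' ≫ δ.app (op W) =
      L.map k ≫ δ.app (op Z) ≫ powersetFunctor.map (T.map b).op := by
    have h1 : δ.app (op Z) ≫ powersetFunctor.map (T.map b).op =
      L.map (powersetFunctor.map b.op) ≫ δ.app (op W) := (δ.naturality b.op).symm
    have h2 : L.map c ≫ L.map k' = L.map k ≫ L.map (powersetFunctor.map b.op) :=
      (L.map_comp _ _).symm.trans ((congrArg L.map h).trans (L.map_comp _ _))
    rw [h1]
    exact (Category.assoc _ _ _).symm.trans ((congrArg (· ≫ δ.app (op W)) h2).trans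
      (Category.assoc _ _ _))
  have h3 : boolPowMap S (powersetFunctor.map (T.map b).op) ≫ powerComparison S (T.obj W) = _ :=
    powerComparison_naturality S (T.map b)
  calc
    _ = boolPowMap S (L.map c ≫ L.map k' ≫ δ.app (op W)) ≫ powerComparison S (T.obj W) := rfl
    _ = boolPowMap S (L.map k ≫ δ.app (op Z) ≫ powersetFunctor.map (T.map b).op) ≫
        powerComparison S (T.obj W) := congrArg (boolPowMap S · ≫ powerComparison S (T.obj W)) hδ
    _ = boolPowMap S (L.map k) ≫ boolPowMap S (δ.app (op Z)) ≫
        boolPowMap S (powersetFunctor.map (T.map b).op) ≫ powerComparison S (T.obj W) := rfl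
    _ = boolPowMap S (L.map k) ≫ boolPowMap S (δ.app (op Z)) ≫
        powerComparison S (T.obj Z) ≫ SetD.precomp ((constLabel S).map (T.map b)) :=
      congrArg (fun z => boolPowMap S (L.map k) ≫ boolPowMap S (δ.app (op Z)) ≫ z) h3
    _ = _ := rfl

theorem liftWedge_condition (X : SetD ℒ D) {S₁ S₂ : ℒ.Substructure D} (h : S₁ ⟶ S₂) :
    liftWedge δ X S₁ ≫ SetD.precomp ((constLabelMap h.le).app (T.obj ((below S₁).obj X))) =
      liftWedge δ X S₂ ≫ SetD.precomp ((constLabel S₂).map (T.map ((belowMap h.le).app X))) :=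
  calc
    _ = (liftLπ L X.prod S₁ ≫ boolPowIncl h.le (L.obj ((skeletonBelow.obj (op S₁)).obj X.prod))) ≫
        boolPowMap S₂ (L.map (skeletonComparison S₁ X)) ≫
        boolPowMap S₂ (δ.app (op ((below S₁).obj X))) ≫
        powerComparison S₂ (T.obj ((below S₁).obj X)) := rfl
    _ = (liftLπ L X.prod S₂ ≫ boolPowMap S₂ (L.map ((skeletonBelow.map h.op).app X.prod))) ≫
        boolPowMap S₂ (L.map (skeletonComparison S₁ X)) ≫
        boolPowMap S₂ (δ.app (op ((below S₁).obj X))) ≫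
        powerComparison S₂ (T.obj ((below S₁).obj X)) := by rw [liftLπ_condition]
    _ = _ := congrArg (liftLπ L X.prod S₂ ≫ ·)
      (liftStep_aux δ S₂ ((belowMap h.le).app X) _ _ _ (skeletonComparison_incl h X))

theorem liftWedge_naturality {X Y : SetD ℒ D} (f : X ⟶ Y) (S : ℒ.Substructure D) :
    (liftL L).map (SetD.precomp f) ≫ liftWedge δ X S =
      liftWedge δ Y S ≫ SetD.precomp ((constLabel S).map (T.map ((below S).map f))) :=
  calc
    _ = ((liftL L).map (SetD.precomp f) ≫ liftLπ L X.prod S) ≫ liftStep δ X S := rfl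
    _ = (liftLπ L Y.prod S ≫
        boolPowMap S (L.map ((skeletonBelow.obj (op S)).map (SetD.precomp f)))) ≫
        liftStep δ X S := by rw [map_liftLπ]
    _ = _ := congrArg (liftLπ L Y.prod S ≫ ·)
      (liftStep_aux δ S ((below S).map f) _ _ _ (skeletonComparison_naturality S f))

/-- The morphism `Y ⟶ S' A` corresponding to a homomorphism `A ⟶ P' Y` under the dual
adjunction. -/
def prodUntranspose {A : Variety ℒ D} {Y : SetD ℒ D} (h : A ⟶ Y.prod) : Y ⟶ A.homs :=
  prodCounit Y ≫ Variety.precomp h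

/-- The homomorphism `A ⟶ P' Y` corresponding to a morphism `Y ⟶ S' A` under the dual
adjunction. -/
def prodTranspose {A : Variety ℒ D} {Y : SetD ℒ D} (g : Y ⟶ A.homs) : A ⟶ Y.prod :=
  prodUnit A ≫ SetD.precomp g

/-- The morphism out of the coend `T' (X, v)` which is the transpose of the wedge above. -/
noncomputable def liftDesc (X : SetD ℒ D) : (liftT T).obj X ⟶ ((liftL L).obj X.prod).homs :=
  coend.desc (F := (coendDiagram T).obj X) (fun S => prodUntranspose (liftWedge δ X S))
    fun _ _ h => congrArg prodUntranspose (liftWedge_condition δ X h)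

theorem liftTι_liftDesc (X : SetD ℒ D) (S : ℒ.Substructure D) :
    liftTι T X S ≫ liftDesc δ X = prodUntranspose (liftWedge δ X S) :=
  coend.ι_desc _ _ S

/-- The component `δ'_{(X, v)} : L' P' (X, v) ⟶ P' T' (X, v)` of the lifting of `δ`. It is the
homomorphism obtained from the wedge above by the universal property of
`P' T' (X, v) ≅ ∫_S P' V^S T C^S (X, v)`. -/
noncomputable def liftApp (X : SetD ℒ D) : (liftL L).obj X.prod ⟶ ((liftT T).obj X).prod :=
  prodTranspose (liftDesc δ X)

/-- The property which characterizes `δ'`. -/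
theorem liftApp_precomp (X : SetD ℒ D) (S : ℒ.Substructure D) :
    liftApp δ X ≫ SetD.precomp (liftTι T X S) = liftWedge δ X S :=
  congrArg prodTranspose (liftTι_liftDesc δ X S)

theorem hom_liftT_ext {A : Variety ℒ D} {X : SetD ℒ D} {f g : A ⟶ ((liftT T).obj X).prod}
    (h : ∀ S, f ≫ SetD.precomp (liftTι T X S) = g ≫ SetD.precomp (liftTι T X S)) : f = g :=
  congrArg prodTranspose (liftT_hom_ext (f := prodUntranspose f) (g := prodUntranspose g)
    fun S => congrArg prodUntranspose (h S))

/-- `δ' : L' P' ⟶ P' T'`, the lifting of `δ`. -/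
noncomputable def liftδ : prodFunctor ⋙ liftL L ⟶ (liftT T : SetD ℒ D ⥤ SetD ℒ D).op ⋙ prodFunctor where
  app X := liftApp δ X.unop
  naturality X Y f := by
    refine hom_liftT_ext fun S => ?_
    calc
      _ = (liftL L).map (SetD.precomp f.unop) ≫ liftApp δ Y.unop ≫
          SetD.precomp (liftTι T Y.unop S) := rfl
      _ = liftWedge δ X.unop S ≫
          SetD.precomp ((constLabel S).map (T.map ((below S).map f.unop))) := by
        rw [liftApp_precomp, liftWedge_naturality]
      _ = liftApp δ X.unop ≫ SetD.precomp
          ((constLabel S).map (T.map ((below S).map f.unop)) ≫ liftTι T X.unop S) := by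
        rw [← liftApp_precomp]
        rfl
      _ = liftApp δ X.unop ≫
          SetD.precomp (liftTι T Y.unop S ≫ (liftT T).map f.unop) := by
        rw [liftTι_map]
      _ = _ := rfl

variable (ℒ D) in
/-- The lifting `(L', δ')` of a classical abstract coalgebraic logic `(L, δ)` for `T`, an abstract
coalgebraic logic for `T'`. -/
noncomputable def AbstractCoalgebraicLogic.lift
    (Λ : AbstractCoalgebraicLogic powersetAdjunction.{u} T) :
    AbstractCoalgebraicLogic (prodAdjunction (ℒ := ℒ) (D := D)) (liftT T) where
  L := liftL Λ.L
  δ := liftδ Λ.δ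

variable (ℒ D) in
/-- The dual adjunction between sets and the variety generated by `D`, obtained by composing
`S' ⊣ P'` with `V^⊤ ⊣ C^⊤ = U`. Its right adjoint `P' V^⊤` sends a set `X` to `D ^ X`. -/
def topAdjunction : (homFunctor : Variety ℒ D ⥤ (SetD ℒ D)ᵒᵖ) ⋙ (below ⊤).op ⊣
    (constLabel ⊤).op ⋙ prodFunctor :=
  prodAdjunction.comp (constLabelAdjunction ⊤).op

variable (ℒ D) in
/-- The canonical morphism `V^⊤ T X ≅ V^⊤ T C^⊤ V^⊤ X ⟶ T' V^⊤ X`. Up to isomorphism, it is the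
identity map of the set `T X`. -/
noncomputable def topComparison (T : Type u ⥤ Type u) (X : Type u) :
    (constLabel (⊤ : ℒ.Substructure D)).obj (T.obj X) ⟶ (liftT T).obj ((constLabel ⊤).obj X) :=
  (constLabel ⊤).map (T.map ((constLabelAdjunction ⊤).unit.app X)) ≫
    liftTι T ((constLabel ⊤).obj X) ⊤

end Lifting

end ManyValued

namespace ManyValued

set_option linter.unusedSectionVars false

/-! ### Monomorphisms as injective homomorphisms -/

section Monomorphisms

variable {ℒ : FirstOrder.Language.{a, b}} {D : Type u} [ℒ.Structure D]

/-! Everything reduces to the component of the end at `⊤`. The inclusions `𝔓_S B → 𝔓_⊤ B` are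
injective, so the wedge condition recovers every projection of `L' A` from the one at `⊤`; hence `L'
A` embeds into `𝔓_⊤ L K_⊤ A` (`liftLπ_top_injective`). In the other direction, each `b` in `L K_⊤ A`
gives a two-valued element of `L' A` (`toSkelLiftL`), because two-valued elements already live in
the Boolean power of the least subalgebra. Also, `A` embeds into `𝔓_⊤ K_⊤ A` by `x ↦ (T_d x)_d`: by
semi-primality the `T_d` are terms which jointly determine `x` (`Variety.indicator_injective`).

One-step completeness: by `topδ_app`, `δ^⊤_X` is the embedding `L' (D ^ X) → 𝔓_⊤ L K_⊤ (D ^ X)`,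
followed by `𝔓_⊤` of `L (K_⊤ (D ^ X) ≅ P X)` and `δ_X`, and by `𝔓_⊤ P T X ≅ D ^ (T X)`. Each factor
is injective when `δ_X` is and `L` preserves monomorphisms.

Expressivity, initial algebra: an `L`-algebra structure on `B` gives an `L'`-algebra structure on
`𝔓_⊤ B`, an `L'`-algebra structure on `A` gives an `L`-algebra structure on `K_⊤ A`, and the
embedding `A → 𝔓_⊤ K_⊤ A` is then a homomorphism of `L'`-algebras. If `B` is initial for `L`, then
`𝔓_⊤ B` maps to `𝔓_⊤ K_⊤ A` for every `A`, and the least subalgebra of `𝔓_⊤ B` closed under the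
structure map is initial for `L'` (`hasInitial_algebra`).

Expressivity, transpose: sending `u : A → D` to the ultrafilter of those `p` with `u p = 1` is an
injection `U S' A → S K_⊤ A`. By `mem_transpose_iff`, the values of the many-valued transpose on the
two-valued elements from `L K_⊤ A` determine the classical transpose at `K_⊤ A` composed with `T` of
this injection. The latter composite is injective, so the many-valued transpose is injective too. -/

theorem Variety.mono_of_injective {A B : Variety ℒ D} (f : A ⟶ B)
    (hf : Function.Injective f.hom) : Mono f where
  right_cancellation g h hgh := by
    ext x
    exact hf (congrArg (fun k => Variety.Hom.hom k x) hgh)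

/-- The kernel pair of a homomorphism. -/
@[ext]
structure Variety.KernelPair {A B : Variety ℒ D} (f : A ⟶ B) : Type u where
  fst : A.carrier
  snd : A.carrier
  eq : f.hom fst = f.hom snd

variable [ℒ.IsAlgebraic]

instance {A B : Variety ℒ D} (f : A ⟶ B) : ℒ.Structure (Variety.KernelPair f) where
  funMap φ x := ⟨funMap φ fun k => (x k).fst, funMap φ fun k => (x k).snd, by
    rw [Variety.hom_funMap, Variety.hom_funMap]
    congr 1
    ext k
    exact (x k).eq⟩
  RelMap r := (IsEmpty.false r).elim

/-- The projections of the kernel pair of a homomorphism. -/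
def Variety.KernelPair.proj {A B : Variety ℒ D} (f : A ⟶ B) (i : Bool) :
    Variety.KernelPair f →[ℒ] A.carrier :=
  homOfFun (fun p => cond i p.fst p.snd) fun _ _ _ => by cases i <;> rfl

/-- The kernel pair is again an algebra of the variety, and a monomorphism identifies its two
projections. -/
theorem Variety.injective_of_mono {A B : Variety ℒ D} (f : A ⟶ B) [Mono f] :
    Function.Injective f.hom := by
  intro x y hxy
  let K : Variety ℒ D :=
    { carrier := Variety.KernelPair f
      mem := .of_jointly_injective (fun _ => A.mem) (Variety.KernelPair.proj f)
        fun p q h => Variety.KernelPair.ext (h true) (h false) }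
  have h : (⟨Variety.KernelPair.proj f true⟩ : K ⟶ A) = ⟨Variety.KernelPair.proj f false⟩ := by
    rw [← cancel_mono f]
    ext p
    exact Variety.KernelPair.eq p
  exact congrArg (fun k => Variety.Hom.hom k (⟨x, y, hxy⟩ : Variety.KernelPair f)) h

/-- The same argument, with the kernel pair as a Boolean subalgebra of `B × B`. It turns the
categorical hypotheses on `δ` into statements about elements, which is what Boolean powers respect.
-/
theorem boolAlg_injective_of_mono {B C : BoolAlg.{u}} (f : B ⟶ C) [Mono f] :
    Function.Injective f := by
  intro x y hxy
  let K : BooleanSubalgebra (B × B) :=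
    { carrier := {p | f p.1 = f p.2}
      supClosed' := fun p hp q hq => by
        change f (p.1 ⊔ q.1) = f (p.2 ⊔ q.2)
        rw [map_sup, map_sup, hp, hq]
      infClosed' := fun p hp q hq => by
        change f (p.1 ⊓ q.1) = f (p.2 ⊓ q.2)
        rw [map_inf, map_inf, hp, hq]
      compl_mem' := fun {p} hp => by
        change f p.1ᶜ = f p.2ᶜ
        rw [map_compl', map_compl', hp]
      bot_mem' := rfl }
  let p₁ : BoolAlg.of K ⟶ B := BoolAlg.ofHom
    { toFun p := p.1.1, map_sup' _ _ := rfl, map_inf' _ _ := rfl, map_top' := rfl, map_bot' := rfl }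
  let p₂ : BoolAlg.of K ⟶ B := BoolAlg.ofHom
    { toFun p := p.1.2, map_sup' _ _ := rfl, map_inf' _ _ := rfl, map_top' := rfl, map_bot' := rfl }
  have h : p₁ = p₂ := by
    rw [← cancel_mono f]
    ext p
    exact p.2
  exact ConcreteCategory.congr_hom h (⟨(x, y), hxy⟩ : K)

theorem boolAlg_mono_of_injective {B C : BoolAlg.{u}} (f : B ⟶ C)
    (hf : Function.Injective f) : Mono f where
  right_cancellation g h hgh := by
    ext x
    exact hf (ConcreteCategory.congr_hom hgh x)

end Monomorphisms

/-! ### Ultrafilters separate the elements of a Boolean algebra -/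

section Ultrafilters

/-- The Boolean prime ideal theorem. -/
theorem BoolUltrafilter.exists_mem_notMem {B : Type u} [BooleanAlgebra B] {x y : B}
    (h : ¬ x ≤ y) : ∃ U : BoolUltrafilter B, x ∈ U.sets ∧ y ∉ U.sets := by
  obtain ⟨J, hJ, hy, hx⟩ := DistribLattice.prime_ideal_of_disjoint_filter_ideal
    (F := Order.PFilter.principal x) (I := Order.Ideal.principal y) (by
      rw [Set.disjoint_left]
      intro z hz hz'
      exact h (le_trans (by simpa using hz) (by simpa using hz')))
  have hyJ : y ∈ J := hy (by simp)
  have hxJ : x ∉ J := fun h' => Set.disjoint_left.1 hx (by simp) h'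
  have hor : ∀ z, z ∈ J ∨ zᶜ ∈ J := fun z => hJ.mem_or_compl_mem
  have htop : ⊤ ∉ J := Order.Ideal.IsProper.top_notMem hJ.toIsProper
  -- The ultrafilter is the complement of a prime ideal which contains `y` and avoids the filter
  -- generated by `x`.
  refine ⟨⟨{z | z ∉ J}, htop, fun p q hp hq hpq => ?_, fun p q hp hpq hq => hp (J.lower hpq hq),
    fun p => ⟨fun hp hp' => (hor p).elim hp' hp, fun hp hp' => ?_⟩⟩, hxJ,
    fun h' => h' hyJ⟩
  · exact (hJ.mem_or_mem hpq).elim hp hq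
  · refine hp fun hp => htop ?_
    rw [← sup_compl_eq_top (x := p)]
    exact Order.Ideal.sup_mem hp hp'

theorem BoolUltrafilter.eq_of_forall_mem_iff {B : Type u} [BooleanAlgebra B] {x y : B}
    (h : ∀ U : BoolUltrafilter B, x ∈ U.sets ↔ y ∈ U.sets) : x = y := by
  by_contra hne
  rcases not_and_or.1 fun h' : x ≤ y ∧ y ≤ x => hne (le_antisymm h'.1 h'.2) with h' | h'
  · obtain ⟨U, h1, h2⟩ := BoolUltrafilter.exists_mem_notMem h'
    exact h2 ((h U).1 h1)
  · obtain ⟨U, h1, h2⟩ := BoolUltrafilter.exists_mem_notMem h'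
    exact h2 ((h U).2 h1)

end Ultrafilters

/-! ### The term operations `T_d` on algebras of the variety -/

section Indicators

variable {ℒ : FirstOrder.Language.{a, b}} {D : Type u} [Fintype D] [ℒ.Structure D]
  [Lattice D] [BoundedOrder D] [BoundedLatticeReduct ℒ D] [SemiPrimal ℒ D] [Nontrivial D]

namespace Variety

theorem T_gen_self (d : D) : (gen : Variety ℒ D).T d d = (⊤ : D) :=
  (exists_indicator_term ℒ d).choose_spec.1 _ rfl

theorem T_gen_of_ne {d e : D} (h : e ≠ d) : (gen : Variety ℒ D).T d e = (⊥ : D) :=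
  (exists_indicator_term ℒ d).choose_spec.2 _ h

variable (A : Variety ℒ D)

/-- In `D` the values of `T_d` are `0` and `1`, which `T_1` fixes; this identity between terms
passes to the whole variety. -/
theorem T_top_T (d : D) (x : A.carrier) : A.T ⊤ (A.T d x) = A.T d x := by
  have h := A.mem 1 ((indicatorTerm ℒ (⊤ : D)).subst fun _ => indicatorTerm ℒ d)
    (indicatorTerm ℒ d) (fun y => by
      rw [Term.realize_subst]
      have hy : (indicatorTerm ℒ d).realize y = (gen : Variety ℒ D).T d (y 0) := by
        rw [T]
        congr 1
        ext i
        rw [Subsingleton.elim i 0]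
      rw [hy]
      by_cases hd : y 0 = d
      · rw [hd, T_gen_self]
        exact T_gen_self ⊤
      · rw [T_gen_of_ne hd]
        exact T_gen_of_ne bot_ne_top) fun _ => x
  rwa [Term.realize_subst] at h

/-- The operation `T_d`, with values in the Boolean skeleton. -/
noncomputable def indicator (d : D) (x : A.carrier) : A.Skel := ⟨A.T d x, A.T_top_T d x⟩

theorem indicator_gen_self (d : D) : (gen : Variety ℒ D).indicator d d = ⊤ :=
  Skel.ext <| (T_gen_self d).trans (eval_gen (ℒ := ℒ) (n := 0) ![] .top).symm

theorem indicator_gen_of_ne {d e : D} (h : e ≠ d) : (gen : Variety ℒ D).indicator d e = ⊥ :=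
  Skel.ext <| (T_gen_of_ne h).trans (eval_gen (ℒ := ℒ) (n := 0) ![] .bot).symm

/-- A family of operations with values in the Boolean skeletons is given by a term. -/
def IsTermOp {n : ℕ} (f : ∀ A : Variety ℒ D, (Fin n → A.carrier) → A.Skel) : Prop :=
  ∃ t : ℒ.Term (Fin n), ∀ A x, (f A x).val = t.realize x

namespace IsTermOp

variable {n : ℕ} {f g : ∀ A : Variety ℒ D, (Fin n → A.carrier) → A.Skel}

/-- The transfer principle: an equation between term operations is an identity, so it may be checked
in `D`. The closure properties below make it applicable to finite meets and joins of indicators. -/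
theorem eq (hf : IsTermOp f) (hg : IsTermOp g) (h : ∀ x : Fin n → D, f gen x = g gen x)
    (A : Variety ℒ D) (x : Fin n → A.carrier) : f A x = g A x := by
  obtain ⟨s, hs⟩ := hf
  obtain ⟨t, ht⟩ := hg
  refine Skel.ext ?_
  rw [hs, ht]
  exact A.mem n s t (fun y => (hs gen y).symm.trans ((congrArg Skel.val (h y)).trans (ht gen y))) x

theorem indicator (d : D) (t : ℒ.Term (Fin n)) :
    IsTermOp fun (A : Variety ℒ D) x => A.indicator d (t.realize x) :=
  ⟨(indicatorTerm ℒ d).subst fun _ => t, fun A x => by rw [Term.realize_subst]; rfl⟩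

theorem inf (hf : IsTermOp f) (hg : IsTermOp g) : IsTermOp fun A x => f A x ⊓ g A x := by
  obtain ⟨s, hs⟩ := hf
  obtain ⟨t, ht⟩ := hg
  refine ⟨.func (BoundedLatticeReduct.infSym (ℒ := ℒ) (D := D)) ![s, t], fun A x => ?_⟩
  change A.inf (f A x).val (g A x).val = _
  rw [Term.realize, Variety.inf, hs, ht]
  congr 1
  ext i
  fin_cases i <;> rfl

theorem sup (hf : IsTermOp f) (hg : IsTermOp g) : IsTermOp fun A x => f A x ⊔ g A x := by
  obtain ⟨s, hs⟩ := hf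
  obtain ⟨t, ht⟩ := hg
  refine ⟨.func (BoundedLatticeReduct.supSym (ℒ := ℒ) (D := D)) ![s, t], fun A x => ?_⟩
  change A.sup (f A x).val (g A x).val = _
  rw [Term.realize, Variety.sup, hs, ht]
  congr 1
  ext i
  fin_cases i <;> rfl

theorem top : IsTermOp fun (A : Variety ℒ D) (_ : Fin n → A.carrier) => (⊤ : A.Skel) := by
  refine ⟨.func (BoundedLatticeReduct.topSym (ℒ := ℒ) (D := D)) ![], fun A x => ?_⟩
  change A.top = _
  rw [Term.realize, Variety.top]
  congr 1
  ext i
  exact i.elim0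

theorem bot : IsTermOp fun (A : Variety ℒ D) (_ : Fin n → A.carrier) => (⊥ : A.Skel) := by
  refine ⟨.func (BoundedLatticeReduct.botSym (ℒ := ℒ) (D := D)) ![], fun A x => ?_⟩
  change A.bot = _
  rw [Term.realize, Variety.bot]
  congr 1
  ext i
  exact i.elim0

theorem finset_inf {ι : Type*} {F : ι → ∀ A : Variety ℒ D, (Fin n → A.carrier) → A.Skel}
    (hF : ∀ i, IsTermOp (F i)) (s : Finset ι) : IsTermOp fun A x => s.inf fun i => F i A x := by
  classical
  induction s using Finset.induction_on with
  | empty => exact top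
  | insert i s _ ih => simpa only [Finset.inf_insert] using (hF i).inf ih

theorem finset_sup {ι : Type*} {F : ι → ∀ A : Variety ℒ D, (Fin n → A.carrier) → A.Skel}
    (hF : ∀ i, IsTermOp (F i)) (s : Finset ι) : IsTermOp fun A x => s.sup fun i => F i A x := by
  classical
  induction s using Finset.induction_on with
  | empty => exact bot
  | insert i s _ ih => simpa only [Finset.sup_insert] using (hF i).sup ih

end IsTermOp

variable {A}

/-- Together with `sup_indicator`, this makes `(T_d x)_d` an element of the Boolean power of `D` by
the Boolean skeleton. -/
theorem indicator_disjoint {d e : D} (h : d ≠ e) (x : A.carrier) :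
    A.indicator d x ⊓ A.indicator e x = ⊥ :=
  IsTermOp.eq ((IsTermOp.indicator d (.var 0)).inf (.indicator e (.var 0))) .bot (fun y => by
    change (gen : Variety ℒ D).indicator d (y 0) ⊓ (gen : Variety ℒ D).indicator e (y 0) = ⊥
    by_cases hd : y 0 = d
    · rw [indicator_gen_of_ne (d := e) fun he => h (hd.symm.trans he), inf_bot_eq]
    · rw [indicator_gen_of_ne hd, bot_inf_eq]) A fun _ : Fin 1 => x

theorem sup_indicator (x : A.carrier) : (Finset.univ.sup fun d : D => A.indicator d x) = ⊤ :=
  IsTermOp.eq (IsTermOp.finset_sup (fun d : D => .indicator d (.var 0)) Finset.univ) .top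
    (fun y => top_le_iff.1 (by
      rw [← indicator_gen_self (ℒ := ℒ) (y 0)]
      exact Finset.le_sup (f := fun d : D => (gen : Variety ℒ D).indicator d (y 0))
        (Finset.mem_univ (y 0)))) A fun _ : Fin 1 => x

/-- In `D` the left side is `0` unless `x = d`, and then the right side is `1`. This is what makes
`x ↦ (T_d x)_d` a homomorphism. -/
theorem inf_indicator_le {n : ℕ} (φ : ℒ.Functions n) (d : Fin n → D) (x : Fin n → A.carrier) :
    (Finset.univ.inf fun i => A.indicator (d i) (x i)) ≤
      A.indicator (funMap φ d) (funMap φ x) := by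
  have hf := IsTermOp.finset_inf (ℒ := ℒ) (D := D) (n := n)
    (fun i => .indicator (d i) (.var i)) Finset.univ
  refine inf_eq_left.1 <| IsTermOp.eq
    (hf.inf (.indicator (funMap φ d) (.func φ fun i => .var i))) hf (fun y => ?_) A x
  change (Finset.univ.inf fun i => (gen : Variety ℒ D).indicator (d i) (y i)) ⊓
    (gen : Variety ℒ D).indicator (funMap φ d) (funMap φ y) =
      Finset.univ.inf fun i => (gen : Variety ℒ D).indicator (d i) (y i)
  by_cases h : y = d
  · rw [h, indicator_gen_self, inf_top_eq]
  · obtain ⟨i, hi⟩ := Function.ne_iff.1 h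
    have : (Finset.univ.inf fun i => (gen : Variety ℒ D).indicator (d i) (y i)) = ⊥ :=
      le_bot_iff.1 ((Finset.inf_le (Finset.mem_univ i)).trans_eq (indicator_gen_of_ne hi))
    rw [this, bot_inf_eq]

theorem top_mem (S : ℒ.Substructure D) : (⊤ : D) ∈ S := by
  have h := S.fun_mem (BoundedLatticeReduct.topSym (ℒ := ℒ) (D := D)) (fun i => i.elim0)
    (fun i => i.elim0)
  rwa [BoundedLatticeReduct.funMap_topSym] at h

theorem bot_mem (S : ℒ.Substructure D) : (⊥ : D) ∈ S := by
  have h := S.fun_mem (BoundedLatticeReduct.botSym (ℒ := ℒ) (D := D)) (fun i => i.elim0)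
    (fun i => i.elim0)
  rwa [BoundedLatticeReduct.funMap_botSym] at h

/-- An element of an algebra is determined by the values of the operations `T_d`. -/
theorem indicator_injective {x y : A.carrier} (h : ∀ d : D, A.indicator d x = A.indicator d y) :
    x = y := by
  classical
  -- Two operations on `D` that preserve all subalgebras: the equality test `e`, and the switch `m`,
  -- which returns its second argument if the first is `1` and its third otherwise. The plan is `x =
  -- m(1, x, y) = m(T_1 e(x, y), x, y) = y`.
  obtain ⟨e, he⟩ := SemiPrimal.exists_term (ℒ := ℒ) (D := D) 2 one_le_two
    (fun z => if z 0 = z 1 then ⊤ else ⊥) (fun S z _ => by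
      split_ifs
      exacts [top_mem S, bot_mem S])
  obtain ⟨m, hm⟩ := SemiPrimal.exists_term (ℒ := ℒ) (D := D) 3 (by norm_num)
    (fun z => if z 0 = ⊤ then z 1 else z 2) (fun S z hz => by
      split_ifs
      exacts [hz 1, hz 2])
  have hle (d : D) : A.indicator d x ⊓ A.indicator d y ≤ A.indicator ⊤ (e.realize ![x, y]) := by
    have hf := (IsTermOp.indicator (ℒ := ℒ) (n := 2) d (.var 0)).inf (.indicator d (.var 1))
    refine inf_eq_left.1 <| IsTermOp.eq (hf.inf (.indicator ⊤ e)) hf (fun z => ?_) A ![x, y]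
    change (gen : Variety ℒ D).indicator d (z 0) ⊓ (gen : Variety ℒ D).indicator d (z 1) ⊓
      (gen : Variety ℒ D).indicator ⊤ (e.realize z) =
      (gen : Variety ℒ D).indicator d (z 0) ⊓ (gen : Variety ℒ D).indicator d (z 1)
    rw [he]
    by_cases h0 : z 0 = d
    · by_cases h1 : z 1 = d
      · rw [if_pos (h0.trans h1.symm), indicator_gen_self, inf_top_eq]
      · rw [indicator_gen_of_ne h1, inf_bot_eq, bot_inf_eq]
    · rw [indicator_gen_of_ne h0, bot_inf_eq, bot_inf_eq]
  -- As `T_d x = T_d y`, every `T_d x` lies below `T_1 e(x, y)`, and the `T_d x` have join `1`.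
  have htop : A.T ⊤ (e.realize ![x, y]) = A.top := by
    refine congrArg Skel.val (top_le_iff.1 ?_ : A.indicator ⊤ (e.realize ![x, y]) = ⊤)
    rw [← sup_indicator x]
    refine Finset.sup_le fun d _ => le_trans (le_inf le_rfl ?_) (hle d)
    rw [h d]
  -- In `D` this holds in both cases: if the test succeeds, the two variables have the same value.
  have h1 := A.mem 2 (m.subst ![(indicatorTerm ℒ (⊤ : D)).subst fun _ => e, .var 0, .var 1])
    (.var 1) (fun z => by
      rw [Term.realize_subst, hm]
      have hz : ((indicatorTerm ℒ (⊤ : D)).subst fun _ => e).realize z =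
          (gen : Variety ℒ D).T ⊤ (if z 0 = z 1 then ⊤ else ⊥ : D) := by
        rw [Term.realize_subst, he]
        rfl
      change (if ((indicatorTerm ℒ (⊤ : D)).subst fun _ => e).realize z = (⊤ : D) then z 0
        else z 1) = z 1
      rw [hz]
      split_ifs with h0 h1 h1
      · exact h0
      · exact absurd (T_gen_self (ℒ := ℒ) (⊤ : D)) h1
      · exact absurd ((T_gen_of_ne (bot_ne_top (α := D))).symm.trans h1) bot_ne_top
      · rfl) ![x, y]
  have h2 := A.mem 2 (m.subst ![.func (BoundedLatticeReduct.topSym (ℒ := ℒ) (D := D)) ![],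
      .var 0, .var 1]) (.var 0) (fun z => by
      rw [Term.realize_subst, hm]
      exact if_pos (BoundedLatticeReduct.funMap_topSym (ℒ := ℒ) (D := D) _)) ![x, y]
  rw [Term.realize_subst] at h1 h2
  refine h2.symm.trans (Eq.trans ?_ h1)
  congr 1
  ext i
  fin_cases i
  · refine Eq.trans ?_ (htop.symm.trans (Term.realize_subst (M := A.carrier)).symm)
    change funMap _ _ = funMap _ _
    congr 1
    ext i
    exact i.elim0
  · rfl
  · rfl

end Variety

end Indicators

/-! ### Boolean skeletons versus Boolean powers -/

section SkeletonPower

variable {ℒ : FirstOrder.Language.{a, b}} [ℒ.IsAlgebraic] {D : Type u} [Fintype D] [ℒ.Structure D]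
  [Lattice D] [BoundedOrder D] [BoundedLatticeReduct ℒ D] [SemiPrimal ℒ D] [Nontrivial D]

open Classical in
/-- The element of a Boolean power which takes the value `1` on `b` and `0` on its complement. -/
noncomputable def BoolPow.twoValued (S : ℒ.Substructure D) {B : Type u} [BooleanAlgebra B]
    (b : B) : BoolPow S B where
  val d := if d = ⊤ then b else if d = ⊥ then bᶜ else ⊥
  eq_bot d hd := by
    rw [if_neg fun h : d = ⊤ => hd (h ▸ Variety.top_mem S),
      if_neg fun h : d = ⊥ => hd (h ▸ Variety.bot_mem S)]
  disjoint d e hde := by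
    split_ifs <;> simp_all
  sup_eq := by
    rw [eq_top_iff, ← sup_compl_eq_top (x := b)]
    refine sup_le ?_ ?_
    · exact le_trans (by simp) (Finset.le_sup (Finset.mem_univ (⊤ : D)))
    · exact le_trans (by simp) (Finset.le_sup (Finset.mem_univ (⊥ : D)))

namespace BoolPow

variable {S : ℒ.Substructure D} {B : Type u} [BooleanAlgebra B]

theorem twoValued_top (b : B) : (twoValued S b).val ⊤ = b := if_pos rfl

theorem twoValued_bot (b : B) : (twoValued S b).val ⊥ = bᶜ := by simp [twoValued]

/-- Two lower bounds give an equality, since partitions of unity that are comparable componentwise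
coincide (`ext_of_le`). -/
theorem twoValued_le {b : B} {ζ : BoolPow S B} (h1 : b ≤ ζ.val ⊤) (h0 : bᶜ ≤ ζ.val ⊥) :
    twoValued S b = ζ := by
  refine ext_of_le fun d => ?_
  by_cases hd : d = ⊤
  · rwa [hd, twoValued_top]
  by_cases hd' : d = ⊥
  · rwa [hd', twoValued_bot]
  · simp [twoValued, hd, hd']

open Classical in
theorem funMap_eq {n : ℕ} {φ : ℒ.Functions n} {ξ : Fin n → BoolPow S B} {ζ : BoolPow S B}
    (h : ∀ x, atom ξ x ≤ ζ.val (funMap φ x)) : funMap φ ξ = ζ := by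
  refine ext_of_le fun d => Finset.sup_le fun x hx => ?_
  rw [Finset.mem_filter] at hx
  exact (h x).trans_eq (congrArg ζ.val hx.2)

/-- The complement of one component of a partition of unity is the join of the others. -/
theorem compl_le {ξ : BoolPow S B} {d : D} {c : B} (h : ∀ e, e ≠ d → ξ.val e ≤ c) :
    (ξ.val d)ᶜ ≤ c := by
  have : (ξ.val d)ᶜ = (ξ.val d)ᶜ ⊓ Finset.univ.sup ξ.val := by rw [ξ.sup_eq, inf_top_eq]
  rw [this, Finset.sup_inf_distrib_left]
  refine Finset.sup_le fun e _ => ?_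
  by_cases hd : e = d
  · rw [hd, compl_inf_eq_bot]
    exact bot_le
  · exact inf_le_right.trans (h e hd)

end BoolPow

/-- In a Boolean power, the operation `T_d` takes `ξ` to the two-valued element given by `ξ d`. -/
theorem boolPow_T (S : ℒ.Substructure D) (B : BoolAlg.{u}) (d : D) (ξ : BoolPow S B) :
    (boolPowObj S B).T d ξ = BoolPow.twoValued S (ξ.val d) := by
  -- Where `ξ` has the value `e`, `T_d ξ` has the value `T_d e`: this is `1` for `e = d` and `0`
  -- otherwise, which gives the two bounds required by `twoValued_le`.
  have h (e : D) : ξ.val e ≤ BoolPow.val ((boolPowObj S B).T d ξ)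
      ((Variety.gen : Variety ℒ D).T d e) := by
    refine le_trans ?_ (BoolPow.le_realize (fun _ : Fin 1 => ξ) (fun _ => e) (indicatorTerm ℒ d))
    simp [BoolPow.atom]
  refine (BoolPow.twoValued_le ?_ (BoolPow.compl_le fun e he => ?_)).symm
  · exact (h d).trans_eq (congrArg _ (Variety.T_gen_self d))
  · exact (h e).trans_eq (congrArg _ (Variety.T_gen_of_ne he))

theorem twoValued_inf (S : ℒ.Substructure D) (B : BoolAlg.{u}) (b c : B) :
    (BoolPow.twoValued S (b ⊓ c) : (boolPowObj S B).carrier) =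
      (boolPowObj S B).inf (BoolPow.twoValued S b) (BoolPow.twoValued S c) := by
  have h (d e : D) : (BoolPow.twoValued S b).val d ⊓ (BoolPow.twoValued S c).val e ≤
      BoolPow.val ((boolPowObj S B).inf (BoolPow.twoValued S b) (BoolPow.twoValued S c))
        (d ⊓ e) := by
    have h1 := BoolPow.le_funMap (BoundedLatticeReduct.infSym (ℒ := ℒ) (D := D))
      ![BoolPow.twoValued S b, BoolPow.twoValued S c] ![d, e]
    rw [BoundedLatticeReduct.funMap_infSym] at h1
    refine le_trans (le_of_eq ?_) h1
    simp [BoolPow.atom, Fin.univ_succ]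
  refine BoolPow.twoValued_le ?_ ?_
  · have := h ⊤ ⊤
    rwa [BoolPow.twoValued_top, BoolPow.twoValued_top, inf_top_eq] at this
  · have h1 := h ⊥ ⊤
    have h2 := h ⊥ ⊥
    have h3 := h ⊤ ⊥
    rw [BoolPow.twoValued_top, BoolPow.twoValued_bot, bot_inf_eq] at h1
    rw [BoolPow.twoValued_bot, BoolPow.twoValued_bot, bot_inf_eq] at h2
    rw [BoolPow.twoValued_top, BoolPow.twoValued_bot, inf_bot_eq] at h3
    -- The complement of `b ⊓ c` is covered by the three regions on which at least one of the two
    -- elements has the value `0`.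
    have hb : bᶜ ≤ (bᶜ ⊓ c) ⊔ (bᶜ ⊓ cᶜ) := by rw [← inf_sup_left, sup_compl_eq_top, inf_top_eq]
    have hc : cᶜ ≤ (b ⊓ cᶜ) ⊔ (bᶜ ⊓ cᶜ) := by rw [← inf_sup_right, sup_compl_eq_top, top_inf_eq]
    rw [compl_inf]
    exact sup_le (hb.trans (sup_le h1 h2)) (hc.trans (sup_le h3 h2))

/-- A Boolean algebra is isomorphic to the Boolean skeleton of any of its Boolean powers. -/
noncomputable def boolPowSkel (S : ℒ.Substructure D) (B : BoolAlg.{u}) :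
    B ≅ skeleton.obj (boolPowObj S B) :=
  BoolAlg.Iso.mk (α := B) (β := .of (boolPowObj S B).Skel)
    { toFun b := ⟨BoolPow.twoValued S b, (boolPow_T S B ⊤ _).trans
        (congrArg (BoolPow.twoValued S) (BoolPow.twoValued_top b))⟩
      invFun p := BoolPow.val p.val ⊤
      left_inv b := BoolPow.twoValued_top b
      -- An element fixed by `T_1` is two-valued, because all values of `T_1` are.
      right_inv p := Variety.Skel.ext ((boolPow_T S B ⊤ p.val).symm.trans p.property)
      map_rel_iff' {b c} := by
        rw [← inf_eq_left, ← inf_eq_left]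
        refine ⟨fun h => ?_, fun h => Variety.Skel.ext ?_⟩
        · have h1 := (twoValued_inf S B b c).trans (congrArg Variety.Skel.val h)
          exact (BoolPow.twoValued_top (S := S) _).symm.trans
            ((congrArg (fun ξ : BoolPow S B => ξ.val ⊤) h1).trans (BoolPow.twoValued_top b))
        · exact (twoValued_inf S B b c).symm.trans (congrArg (BoolPow.twoValued S) h) }

/-- The embedding of an algebra into a Boolean power of `D` by its Boolean skeleton. -/
noncomputable def toBoolPow (A : Variety ℒ D) : A ⟶ boolPowObj ⊤ (skeleton.obj A) :=
  ⟨homOfFun (B := BoolPow (⊤ : ℒ.Substructure D) A.Skel)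
    (fun x => ⟨fun d => A.indicator d x, fun _ hd => (hd trivial).elim,
      fun _ _ h => Variety.indicator_disjoint h x, Variety.sup_indicator x⟩)
    fun _ φ x => (BoolPow.funMap_eq fun e => Variety.inf_indicator_le φ e x).symm⟩

/-- The homomorphism to `D` determined by an ultrafilter of the Boolean skeleton. -/
noncomputable def ultrafilterHom (A : Variety ℒ D) (U : BoolUltrafilter A.Skel) :
    A.carrier →[ℒ] D :=
  (SetD.eval _ U).comp (toBoolPow A ≫ boolPowMap ⊤ (powersetUnit (skeleton.obj A)) ≫
    powerComparison ⊤ (BoolUltrafilter A.Skel)).hom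

theorem ultrafilterHom_eq_iff {A : Variety ℒ D} {U : BoolUltrafilter A.Skel} {x : A.carrier}
    {d : D} : ultrafilterHom A U x = d ↔ A.indicator d x ∈ U.sets :=
  BoolPow.value_eq_iff (S := ⊤) ((boolPowMap ⊤ (powersetUnit (skeleton.obj A))).hom
    ((toBoolPow A).hom x)) U d

/-- Homomorphisms to `D` separate the points of an algebra. -/
theorem eq_of_congr_top {A : Variety ℒ D} {x y : A.carrier} (h : A.congr ⊤ x y) : x = y := by
  -- If `x` and `y` differ, then some `T_d x` and `T_d y` differ, an ultrafilter separates these,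
  -- and its homomorphism to `D` separates `x` and `y`.
  refine Variety.indicator_injective fun d => BoolUltrafilter.eq_of_forall_mem_iff fun U => ?_
  rw [← ultrafilterHom_eq_iff, ← ultrafilterHom_eq_iff, h (ultrafilterHom A U) le_top]

/-- The inverse of the quotient map of an algebra by the congruence determined by `D`. -/
def quotTopInv (A : Variety ℒ D) : A.quot ⊤ ⟶ A :=
  ⟨homOfFun (A := Quotient (A.congr ⊤)) (Quotient.lift id fun _ _ h => eq_of_congr_top h)
    fun n φ x => by
      obtain ⟨y, rfl⟩ : ∃ y : Fin n → A.carrier, x = fun i => Quotient.mk (A.congr ⊤) (y i) :=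
        ⟨fun i => (x i).out, by ext i; exact (Quotient.out_eq _).symm⟩
      exact congrArg (Quotient.lift id fun _ _ h => eq_of_congr_top h)
        (funMap_quotient_mk' (A.congr ⊤) φ y)⟩

/-- The quotient map, as a morphism. -/
def quotTop (A : Variety ℒ D) : A ⟶ A.quot ⊤ := ⟨A.quotMk ⊤⟩

end SkeletonPower

/-! ### Initial algebras as least subalgebras -/

section LeastAlgebra

variable {ℒ : FirstOrder.Language.{a, b}} [ℒ.IsAlgebraic] {D : Type u} [ℒ.Structure D]

/-- A subalgebra of an algebra, as a member of the variety. -/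
def Variety.sub (A : Variety ℒ D) (N : ℒ.Substructure A.carrier) : Variety ℒ D where
  carrier := N
  mem := .of_jointly_injective (ι := Unit) (fun _ => A.mem) (fun _ => N.subtype.toHom)
    fun _ _ h => Subtype.ext (h ())

/-- The inclusion of a subalgebra. -/
def Variety.subι (A : Variety ℒ D) (N : ℒ.Substructure A.carrier) : A.sub N ⟶ A :=
  ⟨N.subtype.toHom⟩

/-- The corestriction of a homomorphism to a subalgebra. -/
def Variety.subLift {A B : Variety ℒ D} {N : ℒ.Substructure A.carrier} (f : B ⟶ A)
    (hf : ∀ x, f.hom x ∈ N) : B ⟶ A.sub N :=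
  ⟨homOfFun (B := N) (fun x => ⟨f.hom x, hf x⟩) fun _ φ x =>
    Subtype.ext (Variety.hom_funMap f φ x)⟩

/-- The lift of a homomorphism through an injective homomorphism. -/
noncomputable def Variety.injLift {A B C : Variety ℒ D} (m : C ⟶ A)
    (hm : Function.Injective m.hom) (f : B ⟶ A) (hf : ∀ x, f.hom x ∈ m.hom.range) : B ⟶ C :=
  ⟨homOfFun (fun x => (hf x).choose) fun n φ x => hm <| by
    rw [(hf _).choose_spec, Variety.hom_funMap, Variety.hom_funMap]
    congr 1
    ext i
    exact (hf _).choose_spec.symm⟩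

theorem Variety.injLift_comp {A B C : Variety ℒ D} (m : C ⟶ A)
    (hm : Function.Injective m.hom) (f : B ⟶ A) (hf : ∀ x, f.hom x ∈ m.hom.range) :
    Variety.injLift m hm f hf ≫ m = f := by
  ext x
  exact (hf x).choose_spec

variable {F : Variety ℒ D ⥤ Variety ℒ D}

/-- A subalgebra which is closed under the structure map of an algebra for an endofunctor. -/
def IsClosedUnder (Q : Endofunctor.Algebra F) (N : ℒ.Substructure Q.a.carrier) : Prop :=
  ∀ x, (F.map (Q.a.subι N) ≫ Q.str).hom x ∈ N

/-- The least closed subalgebra. -/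
def leastClosed (Q : Endofunctor.Algebra F) : ℒ.Substructure Q.a.carrier :=
  sInf {N | IsClosedUnder Q N}

/-- The inclusion of the intersection factors through each closed `N`, so after applying `F` its
image under the structure map stays in `N`. -/
theorem leastClosed_isClosedUnder (Q : Endofunctor.Algebra F) :
    IsClosedUnder Q (leastClosed Q) := by
  intro x
  refine Substructure.mem_sInf.2 fun N hN => ?_
  have hle : leastClosed Q ≤ N := sInf_le hN
  let i : Q.a.sub (leastClosed Q) ⟶ Q.a.sub N :=
    Variety.subLift (Q.a.subι _) fun y => hle y.2
  have hi : F.map (Q.a.subι (leastClosed Q)) = F.map i ≫ F.map (Q.a.subι N) :=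
    F.map_comp i (Q.a.subι N)
  rw [hi]
  exact hN ((F.map i).hom x)

/-- The structure of an algebra for the endofunctor on the least closed subalgebra. -/
def leastAlgebra (Q : Endofunctor.Algebra F) : Endofunctor.Algebra F where
  a := Q.a.sub (leastClosed Q)
  str := Variety.subLift (F.map (Q.a.subι _) ≫ Q.str) (leastClosed_isClosedUnder Q)

/-- The inclusion of the least closed subalgebra. -/
def leastAlgebraι (Q : Endofunctor.Algebra F) : leastAlgebra Q ⟶ Q where
  f := Q.a.subι (leastClosed Q)
  h := rfl

/-- The equalizer of two homomorphisms is closed under the structure map, so by minimality it is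
everything. -/
theorem leastAlgebra_hom_ext {Q A : Endofunctor.Algebra F} (f g : leastAlgebra Q ⟶ A) :
    f = g := by
  let N : ℒ.Substructure Q.a.carrier :=
    { carrier := {x | ∃ h : x ∈ leastClosed Q, f.f.hom ⟨x, h⟩ = g.f.hom ⟨x, h⟩}
      fun_mem := fun φ x hx => by
        choose hx h using hx
        refine ⟨(leastClosed Q).fun_mem φ x hx, ?_⟩
        have h1 := Variety.hom_funMap f.f φ fun i => ⟨x i, hx i⟩
        have h2 := Variety.hom_funMap g.f φ fun i => ⟨x i, hx i⟩
        refine h1.trans (Eq.trans ?_ h2.symm)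
        congr 1
        ext i
        exact h i }
  let i : Q.a.sub N ⟶ (leastAlgebra Q).a := Variety.subLift (Q.a.subι N) fun y => y.2.1
  have hfg : i ≫ f.f = i ≫ g.f := by
    ext y
    exact y.2.2
  have hi : F.map (Q.a.subι N) ≫ Q.str = F.map i ≫ F.map (leastAlgebraι Q).f ≫ Q.str := by
    have h : Q.a.subι N = i ≫ (leastAlgebraι Q).f := rfl
    rw [h, F.map_comp, Category.assoc]
  have hN : IsClosedUnder Q N := by
    intro x
    have hmem := leastClosed_isClosedUnder Q ((F.map i).hom x)
    rw [hi]
    refine ⟨hmem, ?_⟩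
    -- Both sides pass through `F` of the restrictions of `f` and `g` to the equalizer, and these
    -- agree.
    have key : (F.map i ≫ (leastAlgebra Q).str) ≫ f.f = (F.map i ≫ (leastAlgebra Q).str) ≫ g.f := by
      rw [Category.assoc, Category.assoc, ← f.h, ← g.h, ← Category.assoc, ← Category.assoc,
        ← F.map_comp, ← F.map_comp, hfg]
    exact congrArg (fun k => Variety.Hom.hom k x) key
  have hle : leastClosed Q ≤ N := sInf_le hN
  refine Endofunctor.Algebra.Hom.ext (Variety.hom_ext fun y => ?_)
  exact (hle y.2).2

/-- The preimage in `Q` of the image of `A` is closed, so it contains the least closed subalgebra;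
on that, `f` factors through the embedding `m`. -/
theorem leastAlgebra_nonempty_hom {Q R A : Endofunctor.Algebra F} (f : Q ⟶ R) (m : A ⟶ R)
    (hm : Function.Injective m.f.hom) : Nonempty (leastAlgebra Q ⟶ A) := by
  let N : ℒ.Substructure Q.a.carrier := m.f.hom.range.comap f.f.hom
  let g : Q.a.sub N ⟶ A.a := Variety.injLift m.f hm (Q.a.subι N ≫ f.f) fun y => y.2
  have hg : g ≫ m.f = Q.a.subι N ≫ f.f := Variety.injLift_comp _ _ _ _
  have key : (F.map (Q.a.subι N) ≫ Q.str) ≫ f.f = (F.map g ≫ A.str) ≫ m.f := by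
    rw [Category.assoc, Category.assoc, ← f.h, ← m.h, ← Category.assoc, ← Category.assoc,
      ← F.map_comp, ← F.map_comp, hg]
  have hN : IsClosedUnder Q N := fun x =>
    ⟨(F.map g ≫ A.str).hom x, (congrArg (fun k => Variety.Hom.hom k x) key).symm⟩
  have hle : leastClosed Q ≤ N := sInf_le hN
  let i : (leastAlgebra Q).a ⟶ Q.a.sub N :=
    Variety.subLift (Q.a.subι (leastClosed Q)) fun y => hle y.2
  have hi : i ≫ Q.a.subι N = (leastAlgebraι Q).f := rfl
  have := Variety.mono_of_injective m.f hm
  refine ⟨⟨i ≫ g, ?_⟩⟩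
  have hm' : (i ≫ g) ≫ m.f = (leastAlgebraι Q ≫ f).f := by
    rw [Category.assoc, hg, ← Category.assoc, hi]
    rfl
  -- Compatibility with the structure maps may be checked after the monomorphism `m`, where the map
  -- becomes the restriction of `f`.
  rw [← cancel_mono m.f, Category.assoc, ← m.h, ← Category.assoc, ← F.map_comp,
    Category.assoc (leastAlgebra Q).str, hm']
  exact (leastAlgebraι Q ≫ f).h

/-- An endofunctor has an initial algebra as soon as there is an algebra `Q` such that every algebra
embeds into some algebra to which `Q` has a homomorphism. -/
theorem hasInitial_algebra (Q : Endofunctor.Algebra F)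
    (h : ∀ A : Endofunctor.Algebra F, ∃ (R : Endofunctor.Algebra F) (_ : Q ⟶ R) (m : A ⟶ R),
      Function.Injective m.f.hom) : HasInitial (Endofunctor.Algebra F) := by
  have (A : Endofunctor.Algebra F) : Nonempty (leastAlgebra Q ⟶ A) := by
    obtain ⟨R, f, m, hm⟩ := h A
    exact leastAlgebra_nonempty_hom f m hm
  have (A : Endofunctor.Algebra F) : Subsingleton (leastAlgebra Q ⟶ A) := ⟨leastAlgebra_hom_ext⟩
  exact hasInitial_of_unique (leastAlgebra Q)

end LeastAlgebra

/-! ### The lifted functor `L'` and its initial algebra -/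

section LiftedFunctor

variable {ℒ : FirstOrder.Language.{a, b}} [ℒ.IsAlgebraic] {D : Type u} [Fintype D] [ℒ.Structure D]
  [Lattice D] [BoundedOrder D] [BoundedLatticeReduct ℒ D] [SemiPrimal ℒ D] [Nontrivial D]

/-- The Boolean skeleton of the quotient of an algebra determined by `D`. -/
noncomputable abbrev topSkeleton : Variety ℒ D ⥤ BoolAlg.{u} := skeletonBelow.obj (op ⊤)

theorem boolPowMap_injective (S : ℒ.Substructure D) {B C : BoolAlg.{u}} (f : B ⟶ C)
    (hf : Function.Injective f) : Function.Injective (boolPowMap S f).hom := by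
  intro ξ ζ h
  refine BoolPow.ext (funext fun d => hf ?_)
  exact congrArg (fun χ : BoolPow S C => χ.val d) h

theorem boolPowIncl_injective {S₁ S₂ : ℒ.Substructure D} (h : S₁ ≤ S₂) (B : BoolAlg.{u}) :
    Function.Injective (boolPowIncl h B).hom := by
  intro ξ ζ hξ
  exact BoolPow.ext (congrArg (fun χ : BoolPow S₂ B => χ.val) hξ)

variable (L : BoolAlg.{u} ⥤ BoolAlg.{u})

theorem liftL_hom_ext {A C : Variety ℒ D} {f g : C ⟶ (liftL L).obj A}
    (h : ∀ S, f ≫ liftLπ L A S = g ≫ liftLπ L A S) : f = g :=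
  end_.hom_ext h

/-- An element of `L' A` is determined by its component at `⊤`. -/
theorem liftLπ_top_injective (A : Variety ℒ D) : Function.Injective (liftLπ L A ⊤).hom := by
  -- After the injective inclusion `𝔓_S → 𝔓_⊤`, the wedge condition for `S ≤ ⊤` expresses the
  -- projection at `S` through the one at `⊤`.
  have : Mono (liftLπ L A ⊤) := ⟨fun f g h => liftL_hom_ext L fun S => by
    have := Variety.mono_of_injective _ (boolPowIncl_injective (le_top : S ≤ ⊤)
      (L.obj ((skeletonBelow.obj (op S)).obj A)))
    rw [← cancel_mono (boolPowIncl (le_top : S ≤ ⊤) (L.obj ((skeletonBelow.obj (op S)).obj A))),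
      Category.assoc, Category.assoc, liftLπ_condition L A (homOfLE (le_top : S ≤ ⊤)),
      ← Category.assoc, ← Category.assoc, h]⟩
  exact Variety.injective_of_mono _

/-- The embedding into `L' A` of the Boolean power of the least subalgebra. -/
noncomputable def liftLOfBot (A : Variety ℒ D) :
    boolPowObj ⊥ (L.obj (topSkeleton.obj A)) ⟶ (liftL L).obj A :=
  end_.lift (F := (endDiagram L).obj A)
    (fun S => boolPowMap ⊥ (L.map ((skeletonBelow.map (homOfLE (le_top : S ≤ ⊤)).op).app A)) ≫
      boolPowIncl bot_le (L.obj ((skeletonBelow.obj (op S)).obj A)))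
    fun S₁ S₂ h => by
      -- The wedge condition is functoriality of `K_S A` in `S`: passing from `⊤` to `S₁` directly
      -- or through `S₂` is the same.
      have hc : (skeletonBelow.map (homOfLE (le_top : S₁ ≤ ⊤)).op).app A =
          (skeletonBelow.map (homOfLE (le_top : S₂ ≤ ⊤)).op).app A ≫
            (skeletonBelow.map h.op).app A := by
        rw [← NatTrans.comp_app, ← Functor.map_comp]
        rfl
      change _ = (boolPowMap ⊥ (L.map ((skeletonBelow.map (homOfLE (le_top : S₂ ≤ ⊤)).op).app A)) ≫
        boolPowIncl bot_le (L.obj ((skeletonBelow.obj (op S₂)).obj A))) ≫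
          boolPowMap S₂ (L.map ((skeletonBelow.map h.op).app A))
      rw [hc, L.map_comp]
      rfl

theorem liftLOfBot_π_top (A : Variety ℒ D) :
    liftLOfBot L A ≫ liftLπ L A ⊤ = boolPowIncl bot_le (L.obj (topSkeleton.obj A)) := by
  refine (end_.lift_π (F := (endDiagram L).obj A) _ _ ⊤).trans ?_
  have h : (skeletonBelow.map (homOfLE (le_top : (⊤ : ℒ.Substructure D) ≤ ⊤)).op).app A = 𝟙 _ :=
    (congrArg (fun k => NatTrans.app k A) (skeletonBelow.map_id (op ⊤)))
  rw [h, L.map_id]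
  rfl

/-- The homomorphism from `L K_⊤ A` to the Boolean skeleton of `L' A`. -/
noncomputable def toSkelLiftL (A : Variety ℒ D) :
    L.obj (topSkeleton.obj A) ⟶ skeleton.obj ((liftL L).obj A) :=
  (boolPowSkel ⊥ (L.obj (topSkeleton.obj A))).hom ≫ skeleton.map (liftLOfBot L A)

theorem liftLπ_toSkelLiftL (A : Variety ℒ D) (b : L.obj (topSkeleton.obj A)) :
    (liftLπ L A ⊤).hom (Variety.Skel.val (toSkelLiftL L A b)) = BoolPow.twoValued ⊤ b :=
  congrArg (fun k => Variety.Hom.hom k (BoolPow.twoValued ⊥ b)) (liftLOfBot_π_top L A)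

/-- In `L' A`, the operation `T_d` depends on the component at `⊤` only. -/
theorem liftL_indicator (A : Variety ℒ D) (d : D) (x : ((liftL L).obj A).carrier) :
    ((liftL L).obj A).indicator d x =
      toSkelLiftL L A (BoolPow.val ((liftLπ L A ⊤).hom x) d) := by
  -- After the injective projection at `⊤`, both sides become the two-valued element given by the
  -- component at `d`.
  refine Variety.Skel.ext (liftLπ_top_injective L A ?_)
  rw [liftLπ_toSkelLiftL]
  exact (Variety.hom_T (liftLπ L A ⊤) d x).trans (boolPow_T ⊤ _ d _)

/-- The counit `K_⊤ 𝔓_⊤ B ⟶ B`. -/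
noncomputable def topSkeletonCounit (B : BoolAlg.{u}) :
    topSkeleton.obj (boolPowObj (⊤ : ℒ.Substructure D) B) ⟶ B :=
  skeleton.map (quotTopInv _) ≫ (boolPowSkel ⊤ B).inv

theorem topSkeletonCounit_naturality {B C : BoolAlg.{u}} (f : B ⟶ C) :
    topSkeleton.map (boolPowMap (⊤ : ℒ.Substructure D) f) ≫ topSkeletonCounit C =
      topSkeletonCounit B ≫ f := by
  ext ⟨p, hp⟩
  obtain ⟨p, rfl⟩ := Quotient.exists_rep p
  rfl

/-- The unit `A ⟶ 𝔓_⊤ K_⊤ A`. -/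
noncomputable def topSkeletonUnit (A : Variety ℒ D) :
    A ⟶ boolPowObj (⊤ : ℒ.Substructure D) (topSkeleton.obj A) :=
  quotTop A ≫ toBoolPow (A.quot ⊤)

theorem topSkeletonUnit_injective (A : Variety ℒ D) :
    Function.Injective (topSkeletonUnit A).hom := by
  intro x y h
  have h1 : Quotient.mk (A.congr ⊤) x = Quotient.mk (A.congr ⊤) y :=
    Variety.indicator_injective (A := A.quot ⊤) fun d =>
      congrArg (fun χ : BoolPow (⊤ : ℒ.Substructure D) (A.quot ⊤).Skel => χ.val d) h
  exact eq_of_congr_top (Quotient.exact h1)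

/-- The unit sends `p` to `(T_d p)_d`, and the counit reads off the component at `1`, which is `T_1
p = p` on the skeleton. -/
theorem topSkeleton_triangle (A : Variety ℒ D) :
    topSkeleton.map (topSkeletonUnit A) ≫ topSkeletonCounit (topSkeleton.obj A) = 𝟙 _ := by
  ext ⟨p, hp⟩
  obtain ⟨p, rfl⟩ := Quotient.exists_rep p
  exact Variety.Skel.ext hp

variable {L}

/-- The algebra for `L'` on the Boolean power of `D` by the carrier of an algebra for `L`. -/
noncomputable def powerAlgebra (B : Endofunctor.Algebra L) :
    Endofunctor.Algebra (liftL L : Variety ℒ D ⥤ Variety ℒ D) where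
  a := boolPowObj ⊤ B.a
  str := liftLπ L (boolPowObj ⊤ B.a) ⊤ ≫ boolPowMap ⊤ (L.map (topSkeletonCounit B.a) ≫ B.str)

/-- The functoriality of `powerAlgebra`. -/
noncomputable def powerAlgebraMap {B C : Endofunctor.Algebra L} (f : B ⟶ C) :
    (powerAlgebra B : Endofunctor.Algebra (liftL L : Variety ℒ D ⥤ Variety ℒ D)) ⟶
      powerAlgebra C where
  f := boolPowMap ⊤ f.f
  h := by
    have h : L.map (topSkeleton.map (boolPowMap (⊤ : ℒ.Substructure D) f.f)) ≫
        L.map (topSkeletonCounit C.a) ≫ C.str = (L.map (topSkeletonCounit B.a) ≫ B.str) ≫ f.f := by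
      rw [← Category.assoc, ← L.map_comp, topSkeletonCounit_naturality, L.map_comp, Category.assoc,
        Category.assoc, f.h]
    calc
      _ = ((liftL L).map (boolPowMap ⊤ f.f) ≫ liftLπ L (boolPowObj ⊤ C.a) ⊤) ≫
          boolPowMap ⊤ (L.map (topSkeletonCounit C.a) ≫ C.str) := rfl
      _ = (liftLπ L (boolPowObj ⊤ B.a) ⊤ ≫
          boolPowMap ⊤ (L.map (topSkeleton.map (boolPowMap ⊤ f.f)))) ≫
          boolPowMap ⊤ (L.map (topSkeletonCounit C.a) ≫ C.str) := by rw [map_liftLπ]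
      _ = liftLπ L (boolPowObj ⊤ B.a) ⊤ ≫
          boolPowMap ⊤ ((L.map (topSkeletonCounit B.a) ≫ B.str) ≫ f.f) := by
        rw [← h]
        rfl
      _ = _ := rfl

/-- The algebra for `L` on `K_⊤ A`, for an algebra `A` for `L'`. -/
noncomputable def skeletonAlgebra (A : Endofunctor.Algebra (liftL L : Variety ℒ D ⥤ Variety ℒ D)) :
    Endofunctor.Algebra L where
  a := topSkeleton.obj A.a
  str := toSkelLiftL L A.a ≫ skeleton.map (A.str ≫ quotTop A.a)

/-- The unit `A ⟶ 𝔓_⊤ K_⊤ A`, as a homomorphism of algebras for `L'`. -/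
noncomputable def toPowerAlgebra (A : Endofunctor.Algebra (liftL L : Variety ℒ D ⥤ Variety ℒ D)) :
    A ⟶ powerAlgebra (skeletonAlgebra A) where
  f := topSkeletonUnit A.a
  h := by
    -- The triangle identity cancels the counit in the structure map of the power algebra against
    -- the unit.
    have h1 : (liftL L).map (topSkeletonUnit A.a) ≫ (powerAlgebra (skeletonAlgebra A)).str =
        liftLπ L A.a ⊤ ≫ boolPowMap ⊤ (skeletonAlgebra A).str := by
      have h : L.map (topSkeleton.map (topSkeletonUnit A.a)) ≫
          L.map (topSkeletonCounit (topSkeleton.obj A.a)) = 𝟙 _ := by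
        rw [← L.map_comp, topSkeleton_triangle, L.map_id]
      calc
        _ = ((liftL L).map (topSkeletonUnit A.a) ≫ liftLπ L _ ⊤) ≫
            boolPowMap ⊤ (L.map (topSkeletonCounit (topSkeleton.obj A.a)) ≫
              (skeletonAlgebra A).str) := rfl
        _ = (liftLπ L A.a ⊤ ≫ boolPowMap ⊤ (L.map (topSkeleton.map (topSkeletonUnit A.a)))) ≫
            boolPowMap ⊤ (L.map (topSkeletonCounit (topSkeleton.obj A.a)) ≫
              (skeletonAlgebra A).str) := by rw [map_liftLπ]
        _ = liftLπ L A.a ⊤ ≫ boolPowMap ⊤ ((L.map (topSkeleton.map (topSkeletonUnit A.a)) ≫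
            L.map (topSkeletonCounit (topSkeleton.obj A.a))) ≫ (skeletonAlgebra A).str) := rfl
        _ = _ := by
          rw [h]
          rfl
    refine h1.trans ?_
    ext x
    refine BoolPow.ext (funext fun d => Variety.Skel.ext ?_)
    -- At the component `d`, one side applies the structure map to `T_d x` and the other applies
    -- `T_d` to its value at `x`; homomorphisms commute with `T_d`.
    have h2 := congrArg Variety.Skel.val (liftL_indicator L A.a d x)
    refine (congrArg (A.str ≫ quotTop A.a).hom h2.symm).trans ?_
    exact Variety.hom_T (A.str ≫ quotTop A.a) d x

/-- The power algebra of the initial `L`-algebra maps to the power algebra of `K_⊤ A`, into which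
`A` embeds by the unit. -/
theorem hasInitial_algebra_liftL [HasInitial (Endofunctor.Algebra L)] :
    HasInitial (Endofunctor.Algebra (liftL L : Variety ℒ D ⥤ Variety ℒ D)) :=
  hasInitial_algebra (powerAlgebra (⊥_ _)) fun A =>
    ⟨powerAlgebra (skeletonAlgebra A), powerAlgebraMap (initial.to _), toPowerAlgebra A,
      topSkeletonUnit_injective A.a⟩

end LiftedFunctor

/-! ### The logic `(L', δ^⊤)`: one-step completeness and expressivity -/

section TopLogic

variable {ℒ : FirstOrder.Language.{a, b}} [ℒ.IsAlgebraic] {D : Type u} [Fintype D] [ℒ.Structure D]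
  [Lattice D] [BoundedOrder D] [BoundedLatticeReduct ℒ D] [SemiPrimal ℒ D] [Nontrivial D]

theorem powerComparison_injective (S : ℒ.Substructure D) (Y : Type u) :
    Function.Injective (powerComparison S Y).hom := by
  intro (ξ : BoolPow S (Set Y)) (ζ : BoolPow S (Set Y)) h
  refine BoolPow.ext (funext fun d => Set.ext fun y => ?_)
  have hy : ξ.value y = ζ.value y :=
    congrArg (fun α : ((constLabel S).obj Y).Prod => α.val y) h
  rw [← BoolPow.value_eq_iff, ← BoolPow.value_eq_iff, hy]

/-- The isomorphism `K_⊤ (D ^ X) ≅ P X`. -/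
noncomputable def topSkeletonComparison (X : Type u) :
    topSkeleton.obj ((constLabel (⊤ : ℒ.Substructure D)).obj X).prod ⟶
      powersetFunctor.obj (op X) :=
  skeletonComparison ⊤ _ ≫ powersetFunctor.map ((constLabelAdjunction ⊤).unit.app X).op

/-- Skeleton elements are represented by functions with values `0` and `1`, which are determined by
where they are `1`. -/
theorem topSkeletonComparison_injective (X : Type u) :
    Function.Injective (topSkeletonComparison (ℒ := ℒ) (D := D) X) := by
  rintro ⟨p, hp⟩ ⟨q, hq⟩ h
  have hX (x : X) := Set.ext_iff.1 h x
  obtain ⟨α, rfl⟩ := Quotient.exists_rep p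
  obtain ⟨β, rfl⟩ := Quotient.exists_rep q
  refine Variety.Skel.ext (congrArg (Quotient.mk _) (SetD.Prod.ext (funext fun x => ?_)))
  have h1 := Variety.skel_eval (SetD.quotEval _ (⊤ : ℒ.Substructure D) ⟨x, le_rfl⟩) ⟨_, hp⟩
  have h2 := Variety.skel_eval (SetD.quotEval _ (⊤ : ℒ.Substructure D) ⟨x, le_rfl⟩) ⟨_, hq⟩
  have h3 : α.val x = (⊤ : D) ↔ β.val x = (⊤ : D) := hX x
  change α.val x = (⊤ : D) ∨ α.val x = (⊥ : D) at h1
  change β.val x = (⊤ : D) ∨ β.val x = (⊥ : D) at h2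
  rcases h1 with h1 | h1
  · rw [h1, h3.1 h1]
  · rcases h2 with h2 | h2
    · rw [h2, h3.2 h2]
    · rw [h1, h2]

variable {T : Type u ⥤ Type u} (Λ : AbstractCoalgebraicLogic powersetAdjunction.{u} T)

variable (ℒ D) in
theorem topComparison_naturality (T : Type u ⥤ Type u) {X Y : Type u} (f : X ⟶ Y) :
    (constLabel (⊤ : ℒ.Substructure D)).map (T.map f) ≫ topComparison ℒ D T Y =
      topComparison ℒ D T X ≫ (liftT T).map ((constLabel ⊤).map f) := by
  have h : T.map f ≫ T.map ((constLabelAdjunction (⊤ : ℒ.Substructure D)).unit.app Y) =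
      T.map ((constLabelAdjunction (⊤ : ℒ.Substructure D)).unit.app X) ≫
        T.map ((below ⊤).map ((constLabel (⊤ : ℒ.Substructure D)).map f)) := by
    rw [← T.map_comp, ← T.map_comp]
    rfl
  rw [topComparison, topComparison, Category.assoc, liftTι_map, ← Category.assoc,
    ← Functor.map_comp, h, Functor.map_comp, Category.assoc]

variable (ℒ D) in
/-- `δ^⊤`, the logic for `T` with `D`-valued predicates obtained from the lifting. -/
noncomputable def topδ : ((constLabel (⊤ : ℒ.Substructure D)).op ⋙ prodFunctor) ⋙ liftL Λ.L ⟶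
    T.op ⋙ ((constLabel ⊤).op ⋙ prodFunctor) where
  app X := (Λ.lift ℒ D).δ.app (op ((constLabel ⊤).obj X.unop)) ≫
    prodFunctor.map (topComparison ℒ D T X.unop).op
  naturality X Y f := by
    have h1 := (Λ.lift ℒ D).δ.naturality ((constLabel (⊤ : ℒ.Substructure D)).map f.unop).op
    have h2 : prodFunctor.map ((liftT T).map ((constLabel (⊤ : ℒ.Substructure D)).map f.unop)).op ≫
        prodFunctor.map (topComparison ℒ D T Y.unop).op =
        prodFunctor.map (topComparison ℒ D T X.unop).op ≫
          prodFunctor.map ((constLabel (⊤ : ℒ.Substructure D)).map (T.map f.unop)).op := by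
      rw [← Functor.map_comp, ← Functor.map_comp, ← op_comp, ← op_comp, topComparison_naturality]
    have h3 := congrArg (· ≫ prodFunctor.map (topComparison ℒ D T Y.unop).op) h1
    exact h3.trans ((Category.assoc _ _ _).trans
      (congrArg ((Λ.lift ℒ D).δ.app (op ((constLabel ⊤).obj X.unop)) ≫ ·) h2))

/-- Only the coend injection at `⊤` enters `δ^⊤`, so the characterization of `δ'` at `⊤` computes
it. This factorization is the basis of both parts of the theorem. -/
theorem topδ_app (X : Type u) : (topδ ℒ D Λ).app (op X) =
    liftLπ Λ.L ((constLabel ⊤).obj X).prod ⊤ ≫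
      boolPowMap ⊤ (Λ.L.map (topSkeletonComparison X) ≫ Λ.δ.app (op X)) ≫
        powerComparison ⊤ (T.obj X) := by
  -- Naturality of `δ` along the bijection `X → C^⊤ V^⊤ X`, with the identity on the skeleton side.
  have h := liftStep_aux Λ.δ (⊤ : ℒ.Substructure D) ((constLabelAdjunction ⊤).unit.app X)
    (skeletonComparison ⊤ ((constLabel (⊤ : ℒ.Substructure D)).obj X)) (topSkeletonComparison X)
    (𝟙 _) (Category.id_comp _)
  rw [Λ.L.map_id] at h
  calc
    _ = (liftApp Λ.δ ((constLabel (⊤ : ℒ.Substructure D)).obj X) ≫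
        SetD.precomp (liftTι T ((constLabel ⊤).obj X) ⊤)) ≫
        SetD.precomp ((constLabel ⊤).map (T.map ((constLabelAdjunction ⊤).unit.app X))) := rfl
    _ = liftLπ Λ.L ((constLabel ⊤).obj X).prod ⊤ ≫
        (liftStep Λ.δ ((constLabel (⊤ : ℒ.Substructure D)).obj X) ⊤ ≫
        SetD.precomp ((constLabel ⊤).map (T.map ((constLabelAdjunction ⊤).unit.app X)))) := by
      rw [liftApp_precomp]
      rfl
    _ = _ := congrArg (liftLπ Λ.L ((constLabel ⊤).obj X).prod ⊤ ≫ ·) h.symm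

variable (ℒ D) in
/-- The logic `(L', δ^⊤)` for `T` over the dual adjunction with right adjoint `X ↦ D ^ X`. -/
noncomputable abbrev topLogic : AbstractCoalgebraicLogic (topAdjunction ℒ D) T :=
  ⟨liftL Λ.L, topδ ℒ D Λ⟩

/-- All factors in `topδ_app` are injective: the projection at `⊤`, the Boolean power of an
injective map, and the comparison with functions. -/
theorem topLogic_oneStepComplete [Λ.L.PreservesMonomorphisms] (h : Λ.OneStepComplete) :
    (topLogic ℒ D Λ).OneStepComplete := by
  intro X
  refine Variety.mono_of_injective _ ?_
  change Function.Injective ((topδ ℒ D Λ).app (op X.unop)).hom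
  rw [topδ_app]
  have := h X
  have := boolAlg_mono_of_injective _ (topSkeletonComparison_injective (ℒ := ℒ) (D := D) X.unop)
  have hm : Mono (Λ.L.map (topSkeletonComparison (ℒ := ℒ) (D := D) X.unop) ≫ Λ.δ.app X) :=
    mono_comp _ _
  exact (powerComparison_injective _ _).comp
    ((boolPowMap_injective _ _ (boolAlg_injective_of_mono _)).comp (liftLπ_top_injective _ _))

/-- The comparison `K_⊤ A ⟶ P U S' A`. -/
noncomputable def skeletonEval (A : Variety ℒ D) :
    topSkeleton.obj A ⟶ powersetFunctor.obj (op ((below ⊤).obj A.homs)) :=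
  topSkeleton.map ((topAdjunction ℒ D).unit.app A) ≫ topSkeletonComparison _

/-- The map `U S' A ⟶ S K_⊤ A`. -/
noncomputable def homsToUltrafilter (A : Variety ℒ D) :
    (below ⊤).obj A.homs ⟶ (ultrafilterFunctor.obj (topSkeleton.obj A)).unop :=
  powersetCounit _ ≫ (ultrafilterFunctor.map (skeletonEval A)).unop

theorem homsToUltrafilter_injective (A : Variety ℒ D) :
    Function.Injective (homsToUltrafilter A) := by
  intro ⟨u, hu⟩ ⟨v, hv⟩ h
  refine SetD.Below.ext ?_
  change A.carrier →[ℒ] D at u v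
  refine FirstOrder.Language.Hom.ext fun x => ?_
  have hp (p : (A.quot ⊤).Skel) :
      p ∈ (homsToUltrafilter A ⟨u, hu⟩).sets ↔ p ∈ (homsToUltrafilter A ⟨v, hv⟩).sets := by
    rw [h]
  -- The test element `T_{v x} x` is sent to `1` by `v`, and to `0` by `u` if `u x ≠ v x`.
  have h1 : u (A.T (v x) x) = (⊤ : D) ↔ v (A.T (v x) x) = (⊤ : D) :=
    hp (skeleton.map (quotTop A) (A.indicator (v x) x))
  have h2 (w : A.carrier →[ℒ] D) : w (A.T (v x) x) = (Variety.gen : Variety ℒ D).T (v x) (w x) :=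
    Variety.hom_T (B := .gen) ⟨w⟩ (v x) x
  rw [h2, h2, Variety.T_gen_self] at h1
  by_contra hne
  exact bot_ne_top ((Variety.T_gen_of_ne hne).symm.trans (h1.2 rfl))

/-- The two maps are transposes of each other under the classical dual adjunction. -/
theorem powersetUnit_homsToUltrafilter (A : Variety ℒ D) :
    powersetUnit (topSkeleton.obj A) ≫ powersetFunctor.map (homsToUltrafilter A).op =
      skeletonEval A := rfl

/-- A point of `U S' A`, as a homomorphism. -/
def pointHom {A : Variety ℒ D} (u : (below (⊤ : ℒ.Substructure D)).obj A.homs) :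
    A.carrier →[ℒ] D := SetD.Below.val u

/-- The bridge between the two transposes: an element `b` of `L K_⊤ A` is tested either classically,
by membership, or as a two-valued element of `L' A`, by evaluation. -/
theorem mem_transpose_iff (A : Variety ℒ D) (t : T.obj ((below ⊤).obj A.homs))
    (b : Λ.L.obj (topSkeleton.obj A)) :
    b ∈ BoolUltrafilter.sets (Λ.transpose (topSkeleton.obj A) (T.map (homsToUltrafilter A) t)) ↔
      pointHom (A := (liftL Λ.L).obj A) ((topLogic ℒ D Λ).transpose A t)
        (Variety.Skel.val (toSkelLiftL Λ.L A b)) = (⊤ : D) := by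
  let X : Type u := (below ⊤).obj A.homs
  let η : A ⟶ ((constLabel (⊤ : ℒ.Substructure D)).obj X).prod := (topAdjunction ℒ D).unit.app A
  let y := Variety.Skel.val (toSkelLiftL Λ.L A b)
  -- The classical side, moved from `S K_⊤ A` to `U S' A` by naturality of `δ`.
  have hl : Λ.L.map (powersetUnit (topSkeleton.obj A)) ≫
      Λ.δ.app (op (BoolUltrafilter (topSkeleton.obj A))) ≫
        powersetFunctor.map (T.map (homsToUltrafilter A)).op =
      Λ.L.map (topSkeleton.map η) ≫ Λ.L.map (topSkeletonComparison X) ≫ Λ.δ.app (op X) := by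
    have hδ := Λ.δ.naturality (homsToUltrafilter A).op
    refine (congrArg (_ ≫ ·) hδ.symm).trans ?_
    refine (Category.assoc _ _ _).symm.trans (Eq.trans ?_ (Category.assoc _ _ _))
    refine congrArg (· ≫ Λ.δ.app (op X)) ?_
    exact (Λ.L.map_comp _ _).symm.trans ((congrArg Λ.L.map
      (powersetUnit_homsToUltrafilter A)).trans (Λ.L.map_comp _ _))
  -- The many-valued side: at `⊤`, the image of `y` under `L' η` is two-valued on the image of `b`,
  -- so its component at `1` is that image.
  have hπ : BoolPow.val ((liftLπ Λ.L _ ⊤).hom (((liftL Λ.L).map η).hom y)) ⊤ =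
      Λ.L.map (topSkeleton.map η) b := by
    have h1 := congrArg (fun k => Variety.Hom.hom k y) (map_liftLπ Λ.L η ⊤)
    have h2 := liftLπ_toSkelLiftL Λ.L A b
    refine (congrArg (fun ξ => BoolPow.val ξ ⊤) (h1.trans (congrArg (boolPowMap ⊤
      (Λ.L.map (topSkeleton.map η))).hom h2))).trans ?_
    exact congrArg (Λ.L.map (topSkeleton.map η)) (BoolPow.twoValued_top b)
  have hr : SetD.Prod.val (((topδ ℒ D Λ).app (op X)).hom (((liftL Λ.L).map η).hom y)) t = ⊤ ↔
      Membership.mem (γ := Set (T.obj X))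
        ((Λ.L.map (topSkeletonComparison (ℒ := ℒ) (D := D) X) ≫ Λ.δ.app (op X))
          (Λ.L.map (topSkeleton.map η) b)) t := by
    rw [topδ_app, ← hπ]
    exact BoolPow.value_eq_iff (S := (⊤ : ℒ.Substructure D)) _ t ⊤
  refine Iff.trans (Eq.to_iff ?_) hr.symm
  exact congrArg (fun k : Λ.L.obj (topSkeleton.obj A) ⟶ powersetFunctor.obj (op (T.obj X)) =>
    Membership.mem (γ := Set (T.obj X)) (k b) t) hl

theorem topLogic_expressive
    (h : Λ.Expressive (.monomorphisms (Type u)) (.epimorphisms (Type u))) :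
    (topLogic ℒ D Λ).Expressive (.monomorphisms (Type u)) (.epimorphisms (Type u)) where
  hasInitial := by
    have := h.hasInitial
    exact hasInitial_algebra_liftL
  le_monomorphisms := h.le_monomorphisms
  le_epimorphisms := h.le_epimorphisms
  hasFactorization := h.hasFactorization
  hasLiftingProperty := h.hasLiftingProperty
  map_mem := h.map_mem
  transpose_mem A := by
    refine (mono_iff_injective _).2 fun t t' htt' => ?_
    have h1 := (mono_iff_injective _).1 (h.map_mem (homsToUltrafilter A)
      ((mono_iff_injective _).2 (homsToUltrafilter_injective A)))
    have h2 := (mono_iff_injective _).1 (h.transpose_mem (topSkeleton.obj A))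
    -- Both `T` of the injection into ultrafilters and the classical transpose at `K_⊤ A` are
    -- injective, so it suffices to compare two ultrafilters.
    refine h1 (h2 (BoolUltrafilter.ext' fun b => ?_))
    have h3 := mem_transpose_iff Λ A t b
    rw [htt'] at h3
    exact h3.trans (mem_transpose_iff Λ A t' b).symm

end TopLogic

end ManyValued

theorem corollary4p8 {ℒ : FirstOrder.Language.{a, b}} [ℒ.IsAlgebraic]
    (D : Type u) [Fintype D] [Nontrivial D] [ℒ.Structure D]
    [Lattice D] [BoundedOrder D] [ManyValued.BoundedLatticeReduct ℒ D] [ManyValued.SemiPrimal ℒ D]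
    (T : Type u ⥤ Type u) [T.PreservesMonomorphisms] [T.PreservesEpimorphisms]
    (Λ : ManyValued.AbstractCoalgebraicLogic ManyValued.powersetAdjunction.{u} T)
    [Λ.L.PreservesMonomorphisms] [Λ.L.PreservesEpimorphisms] :
    ∃ δtop : ((ManyValued.constLabel ⊤).op ⋙ ManyValued.prodFunctor) ⋙
          (ManyValued.liftL Λ.L : ManyValued.Variety ℒ D ⥤ ManyValued.Variety ℒ D) ⟶
        T.op ⋙ ((ManyValued.constLabel ⊤).op ⋙ ManyValued.prodFunctor),
      (∀ X : Type u, δtop.app (op X) =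
        (Λ.lift ℒ D).δ.app (op ((ManyValued.constLabel ⊤).obj X)) ≫
          ManyValued.prodFunctor.map (ManyValued.topComparison ℒ D T X).op) ∧
      (Λ.OneStepComplete →
        (⟨ManyValued.liftL Λ.L, δtop⟩ : ManyValued.AbstractCoalgebraicLogic
          (ManyValued.topAdjunction ℒ D) T).OneStepComplete) ∧
      (Λ.Expressive (.monomorphisms (Type u)) (.epimorphisms (Type u)) →
        (⟨ManyValued.liftL Λ.L, δtop⟩ : ManyValued.AbstractCoalgebraicLogic
          (ManyValued.topAdjunction ℒ D) T).Expressive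
            (.monomorphisms (Type u)) (.epimorphisms (Type u))) := by
  exact ⟨ManyValued.topδ ℒ D Λ, fun _ => rfl, ManyValued.topLogic_oneStepComplete Λ,
    ManyValued.topLogic_expressive Λ⟩
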